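/- Let $d_A,d_B\in\mathbb N$ and let $U$ be a permutation unitary on $\mathbb C^{d_A}\otimes\mathbb C^{d_B}$, i.e. a unitary matrix in the computational product basis all of whose entries are $0$ or $1$. Suppose that $U$ has Schmidt rank $2$, i.e. $U=A_1\otimes B_1+A_2\otimes B_2$ with $A_1,A_2$ linearly independent $d_A\times d_A$ matrices and $B_1,B_2$ linearly independent $d_B\times d_B$ matrices. For a bipartite pure state $|\psi\rangle$ let $E(\psi)$ be the von Neumann entropy (with $\log_2$) of its reduced density matrix on one of the two sides. Then: (1) The entangling power of $U$ is $1$ ebit: $$K_E(U)=\max_{|\alpha\rangle,|\beta\rangle}E\bigl(U(|\alpha\rangle|\beta\rangle)\bigr)=1,$$ where the maximum is attained and runs over all pure states $|\alpha\rangle$ of $AR_A$ and $|\beta\rangle$ of $BR_B$ with local ancillas $R_A,R_B$ of arbitrary finite dimensions, $U$ acts on $AB$, and the entanglement is taken across the cut $AR_A:BR_B$. (2) The entanglement cost of $U$ is $1$ ebit: $$E_c(U)=\inf_p E_c(p)=1,$$ where $p$ runs over all one-shot exact deterministic LOCC protocols for $U$, that is, all protocols of finitely many rounds of local quantum operations (with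 finitely many outcomes, and finite-dimensional ancillas of arbitrary dimension) and classical communication which, given one copy of a bipartite pure resource state $|\psi\rangle$ of finite dimensions, implement on $AB$ exactly the channel $\rho\mapsto U\rho U^\dagger$; and $E_c(p)=E(\psi)$ is the amount of initial entanglement. Neither the dimensions of the resource state and of the ancillas nor the number of rounds is bounded over the set of protocols. -/

import Mathlib

open scoped Matrix Kronecker

noncomputable section

/-! Operators on `ℂ^{dA} ⊗ ℂ^{dB}` are matrices indexed by `Fin dA × Fin dB`, vectors of a
bipartite space `ℂ^α ⊗ ℂ^β` are functions `α × β → ℂ`. -/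

/-- A permutation unitary: a unitary matrix all of whose entries are `0` or `1`. -/
def IsPermutationUnitary {ι : Type*} [Fintype ι] [DecidableEq ι] (U : Matrix ι ι ℂ) : Prop :=
  U ∈ Matrix.unitaryGroup ι ℂ ∧ ∀ i j, U i j = 0 ∨ U i j = 1

/-- The bipartite operator `U` has Schmidt rank `r`: it is a sum of `r` terms `S j ⊗ T j` with the
`S j` linearly independent and the `T j` linearly independent. -/
def HasSchmidtRank {dA dB : ℕ} (U : Matrix (Fin dA × Fin dB) (Fin dA × Fin dB) ℂ) (r : ℕ) : Prop :=
  ∃ (S : Fin r → Matrix (Fin dA) (Fin dA) ℂ) (T : Fin r → Matrix (Fin dB) (Fin dB) ℂ),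
    LinearIndependent ℂ S ∧ LinearIndependent ℂ T ∧ U = ∑ j, S j ⊗ₖ T j

/-- `ψ` is a pure state, that is, a vector of Euclidean norm one. -/
def IsPureState {ι : Type*} [Fintype ι] (ψ : ι → ℂ) : Prop :=
  ∑ i, ‖ψ i‖ ^ 2 = 1

/-- The reduced density matrix `Tr_B |ψ⟩⟨ψ|` of a bipartite vector on its first factor. -/
def reducedState {α β : Type*} [Fintype β] (ψ : α × β → ℂ) : Matrix α α ℂ :=
  Matrix.of fun i j => ∑ k, ψ (i, k) * star (ψ (j, k))

theorem reducedState_isHermitian {α β : Type*} [Fintype β] (ψ : α × β → ℂ) :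
    (reducedState ψ).IsHermitian := by
  ext i j
  simp [reducedState, Matrix.conjTranspose_apply, mul_comm]

/-- The von Neumann entropy `-Tr ρ log₂ ρ`, in ebits (with `0 log 0 = 0`). -/
def vonNeumannEntropy {α : Type*} [Fintype α] [DecidableEq α] (ρ : Matrix α α ℂ)
    (hρ : ρ.IsHermitian) : ℝ :=
  -∑ i, hρ.eigenvalues i * Real.logb 2 (hρ.eigenvalues i)

/-- The entanglement, in ebits, of a bipartite pure state: the von Neumann entropy of its reduced
density matrix. -/
def entanglement {α β : Type*} [Fintype α] [DecidableEq α] [Fintype β] (ψ : α × β → ℂ) : ℝ :=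
  vonNeumannEntropy (reducedState ψ) (reducedState_isHermitian ψ)

/-- The vector `(U_{AB} ⊗ 1)(|α⟩_{A R_A} ⊗ |β⟩_{B R_B})`, as a bipartite vector with respect to
the cut `A R_A : B R_B`. -/
def outputState {dA dB rA rB : ℕ} (U : Matrix (Fin dA × Fin dB) (Fin dA × Fin dB) ℂ)
    (α : Fin dA × Fin rA → ℂ) (β : Fin dB × Fin rB → ℂ) :
    (Fin dA × Fin rA) × (Fin dB × Fin rB) → ℂ :=
  fun x => ∑ p : Fin dA × Fin dB, U (x.1.1, x.2.1) p * (α (p.1, x.1.2) * β (p.2, x.2.2))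

/-- The amounts of entanglement that `U` creates from product pure states, with local ancillas
`R_A`, `R_B` of arbitrary finite dimensions. -/
def createdEntanglements {dA dB : ℕ} (U : Matrix (Fin dA × Fin dB) (Fin dA × Fin dB) ℂ) : Set ℝ :=
  {e | ∃ (rA rB : ℕ) (α : Fin dA × Fin rA → ℂ) (β : Fin dB × Fin rB → ℂ),
    IsPureState α ∧ IsPureState β ∧ e = entanglement (outputState U α β)}

/-- `e` is the entangling power of `U`: the maximum of the entanglement created from product
states. -/
def IsEntanglingPower {dA dB : ℕ} (U : Matrix (Fin dA × Fin dB) (Fin dA × Fin dB) ℂ)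
    (e : ℝ) : Prop :=
  IsGreatest (createdEntanglements U) e

/-- LOCC protocols that start on `ℂ^a ⊗ ℂ^b` and end on `ℂ^{a'} ⊗ ℂ^{b'}`, as finite trees.
In each step one party applies a local quantum operation with Kraus operators `K i`, the
outcome `i` is announced, and the rest of the protocol depends on `i`. The dimension of the local
space may change, so that local ancillas can be added and discarded in a step; a party discards
a system by measuring it, the later steps being free to ignore any part of an announced outcome. -/
inductive LOCC (a' b' : ℕ) : ℕ → ℕ → Type
  | halt : LOCC a' b' a' b'
  | alice {a b : ℕ} (k : ℕ) (c : Fin k → ℕ) (K : (i : Fin k) → Matrix (Fin (c i)) (Fin a) ℂ)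
      (hK : ∑ i, (K i)ᴴ * K i = 1) (next : (i : Fin k) → LOCC a' b' (c i) b) : LOCC a' b' a b
  | bob {a b : ℕ} (k : ℕ) (c : Fin k → ℕ) (K : (i : Fin k) → Matrix (Fin (c i)) (Fin b) ℂ)
      (hK : ∑ i, (K i)ᴴ * K i = 1) (next : (i : Fin k) → LOCC a' b' a (c i)) : LOCC a' b' a b

/-- The quantum channel carried out by a protocol: the sum over all the sequences of outcomes. -/
def LOCC.channel {a' b' : ℕ} : {a b : ℕ} → LOCC a' b' a b →
    Matrix (Fin a × Fin b) (Fin a × Fin b) ℂ → Matrix (Fin a' × Fin b') (Fin a' × Fin b') ℂ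
  | _, _, .halt, ρ => ρ
  | _, b, .alice _ _ K _ next, ρ => ∑ i, (next i).channel
      ((K i ⊗ₖ (1 : Matrix (Fin b) (Fin b) ℂ)) * ρ * (K i ⊗ₖ (1 : Matrix (Fin b) (Fin b) ℂ))ᴴ)
  | a, _, .bob _ _ K _ next, ρ => ∑ i, (next i).channel
      (((1 : Matrix (Fin a) (Fin a) ℂ) ⊗ₖ K i) * ρ * ((1 : Matrix (Fin a) (Fin a) ℂ) ⊗ₖ K i)ᴴ)

/-- The operator `ρ_{AB} ⊗ |ψ⟩⟨ψ|_{A'B'}`, where Alice holds `AA'` and Bob holds `BB'`. -/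
def withResource {dA dB m n : ℕ} (ρ : Matrix (Fin dA × Fin dB) (Fin dA × Fin dB) ℂ)
    (ψ : Fin m × Fin n → ℂ) :
    Matrix (Fin (dA * m) × Fin (dB * n)) (Fin (dA * m) × Fin (dB * n)) ℂ :=
  let e : (Fin dA × Fin dB) × (Fin m × Fin n) ≃ Fin (dA * m) × Fin (dB * n) :=
    (Equiv.prodProdProdComm (Fin dA) (Fin dB) (Fin m) (Fin n)).trans
      (Equiv.prodCongr finProdFinEquiv finProdFinEquiv)
  Matrix.reindex e e (ρ ⊗ₖ Matrix.vecMulVec ψ (star ψ))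

/-- The protocol `P`, run on one copy of the resource state `ψ`, implements `U` exactly and
deterministically: the resulting channel is `ρ ↦ U ρ U†`. (Both sides are linear in `ρ`, so this
is the same for all matrices `ρ` as for all density matrices.) -/
def LOCC.Implements {dA dB m n : ℕ} (P : LOCC dA dB (dA * m) (dB * n)) (ψ : Fin m × Fin n → ℂ)
    (U : Matrix (Fin dA × Fin dB) (Fin dA × Fin dB) ℂ) : Prop :=
  ∀ ρ : Matrix (Fin dA × Fin dB) (Fin dA × Fin dB) ℂ,
    P.channel (withResource ρ ψ) = U * ρ * Uᴴ

/-- The amounts of initial entanglement in the resource states of the one-shot exact deterministic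
LOCC protocols that implement `U`. -/
def sufficientEntanglements {dA dB : ℕ} (U : Matrix (Fin dA × Fin dB) (Fin dA × Fin dB) ℂ) :
    Set ℝ :=
  {e | ∃ (m n : ℕ) (ψ : Fin m × Fin n → ℂ) (P : LOCC dA dB (dA * m) (dB * n)),
    IsPureState ψ ∧ P.Implements ψ U ∧ e = entanglement ψ}

/-- `e` is the entanglement cost of `U`: the infimum, over the protocols that implement `U`, of
the initial entanglement. -/
def IsEntanglementCost {dA dB : ℕ} (U : Matrix (Fin dA × Fin dB) (Fin dA × Fin dB) ℂ)
    (e : ℝ) : Prop :=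
  IsGLB (sufficientEntanglements U) e

end

open scoped Matrix Kronecker

noncomputable section

/-! ### Entropy bounds -/

/-! Everything rests on one structural fact: `U` is a controlled permutation `P ⊗ V + Q ⊗ W`, with
the control on one of the two sides. Realign `U` into the matrix with rows `(i, j)` from A and
columns `(k, l)` from B, whose rank is the Schmidt rank. It has an identity 2×2 minor
(`IsPermutationUnitary.exists_identity_minor`), since otherwise the permutation would act separately
on the two factors and have Schmidt rank one. The skeleton decomposition through this minor gives `U
= A ⊗ X + B ⊗ Y`, where all four factors are blocks of `U`, hence partial permutations. Each row of
`U` contains exactly one 1, so the row supports of the two terms cut a rectangle into two nonempty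
rectangles. Such a cut is straight (`forall_or_forall_of_xor`): one pair of factors has full
support, the other complementary supports. The same holds for columns.

Entangling power: two product terms give a reduced state of rank at most two, hence at most one
ebit. A superposition of two control states, with a target state on which the controlled
permutations differ, yields a Bell state.

Cost: one ebit suffices by an explicit protocol (`IsControlPair.protocol_implements`). For the lower
bound the monotone is the largest Schmidt coefficient, expressed through overlaps with product
vectors. Bounds on the branches of a measurement pull back by Cauchy–Schwarz, and exactness makes
every final branch proportional to the target Bell state. So the largest Schmidt coefficient of the
resource is at most 1/2, and its entropy is at least its min-entropy, which is at least 1. -/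

theorem vonNeumannEntropy_le_one {α : Type*} [Fintype α] [DecidableEq α] {ρ : Matrix α α ℂ}
    (hρ : ρ.IsHermitian) (hpos : ∀ i, 0 ≤ hρ.eigenvalues i) (hsum : ∑ i, hρ.eigenvalues i = 1)
    (hrank : ρ.rank ≤ 2) : vonNeumannEntropy ρ hρ ≤ 1 := by
  have hlog : 0 < Real.log 2 := Real.log_pos one_lt_two
  rw [hρ.rank_eq_card_non_zero_eigs, Fintype.card_subtype] at hrank
  -- Tangent bound `log x ≤ x - 1` at `x = 1 / (2λ)`, tight at `λ = 1/2`. Summed over at most two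
  -- nonzero eigenvalues it gives `(log 2 - 1) + 2 · (1/2) = log 2`.
  have key : ∀ i, -(hρ.eigenvalues i * Real.log (hρ.eigenvalues i)) ≤
      hρ.eigenvalues i * (Real.log 2 - 1) + if hρ.eigenvalues i ≠ 0 then 1 / 2 else 0 := by
    intro i
    by_cases h0 : hρ.eigenvalues i = 0
    · simp [h0]
    · have hp : 0 < hρ.eigenvalues i := lt_of_le_of_ne (hpos i) (Ne.symm h0)
      have h1 := Real.log_le_sub_one_of_pos (x := (2 * hρ.eigenvalues i)⁻¹) (by positivity)
      rw [Real.log_inv, Real.log_mul two_ne_zero h0] at h1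
      have h2 := mul_le_mul_of_nonneg_left h1 hp.le
      have h3 : hρ.eigenvalues i * ((2 * hρ.eigenvalues i)⁻¹ - 1) =
          1 / 2 - hρ.eigenvalues i := by field_simp
      rw [if_pos h0]
      linarith
  have htot := Finset.sum_le_sum fun i (_ : i ∈ Finset.univ) => key i
  rw [Finset.sum_add_distrib, ← Finset.sum_mul, hsum, ← Finset.sum_filter, Finset.sum_const,
    nsmul_eq_mul, Finset.sum_neg_distrib] at htot
  have hcard : (((Finset.univ.filter fun i => hρ.eigenvalues i ≠ 0).card : ℕ) : ℝ) ≤ 2 := by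
    exact_mod_cast hrank
  have : vonNeumannEntropy ρ hρ =
      (-∑ i, hρ.eigenvalues i * Real.log (hρ.eigenvalues i)) / Real.log 2 := by
    simp only [vonNeumannEntropy, Real.logb, neg_div, Finset.sum_div, mul_div_assoc]
  rw [this, div_le_one hlog]
  linarith

theorem one_le_vonNeumannEntropy {α : Type*} [Fintype α] [DecidableEq α] {ρ : Matrix α α ℂ}
    (hρ : ρ.IsHermitian) (hpos : ∀ i, 0 ≤ hρ.eigenvalues i) (hsum : ∑ i, hρ.eigenvalues i = 1)
    (hle : ∀ i, hρ.eigenvalues i ≤ 1 / 2) : 1 ≤ vonNeumannEntropy ρ hρ := by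
  have key : ∀ i, hρ.eigenvalues i * Real.logb 2 (hρ.eigenvalues i) ≤ -hρ.eigenvalues i := by
    intro i
    rcases (hpos i).eq_or_lt with h0 | hp
    · simp [← h0]
    · have h1 : Real.logb 2 (hρ.eigenvalues i) ≤ -1 := by
        rw [Real.logb_le_iff_le_rpow one_lt_two hp, Real.rpow_neg_one]
        simpa using hle i
      nlinarith
  have htot := Finset.sum_le_sum fun i (_ : i ∈ Finset.univ) => key i
  rw [Finset.sum_neg_distrib, hsum] at htot
  unfold vonNeumannEntropy
  linarith

/-! ### Overlaps with product vectors -/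

/-- The square of the Euclidean norm. -/
def sqNorm {ι : Type*} [Fintype ι] (a : ι → ℂ) : ℝ := ∑ i, ‖a i‖ ^ 2

theorem sqNorm_nonneg {ι : Type*} [Fintype ι] (a : ι → ℂ) : 0 ≤ sqNorm a :=
  Finset.sum_nonneg fun _ _ => by positivity

theorem star_dotProduct_self {ι : Type*} [Fintype ι] (a : ι → ℂ) :
    star a ⬝ᵥ a = (sqNorm a : ℂ) := by
  simp [dotProduct, sqNorm, Complex.conj_mul']

theorem sqNorm_star {ι : Type*} [Fintype ι] (a : ι → ℂ) : sqNorm (star a) = sqNorm a := by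
  simp [sqNorm]

theorem sqNorm_smul {ι : Type*} [Fintype ι] (c : ℂ) (a : ι → ℂ) :
    sqNorm (c • a) = ‖c‖ ^ 2 * sqNorm a := by
  simp [sqNorm, mul_pow, Finset.mul_sum]

theorem eq_zero_of_sqNorm_eq_zero {ι : Type*} [Fintype ι] {a : ι → ℂ} (h : sqNorm a = 0) :
    a = 0 := by
  rw [sqNorm, Finset.sum_eq_zero_iff_of_nonneg fun _ _ => by positivity] at h
  ext i
  simpa using h i (Finset.mem_univ i)

/-- The product vector `|a⟩|b⟩`. -/
def prodVec {α β : Type*} (a : α → ℂ) (b : β → ℂ) : α × β → ℂ := fun x => a x.1 * b x.2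

theorem sqNorm_prodVec {α β : Type*} [Fintype α] [Fintype β] (a : α → ℂ) (b : β → ℂ) :
    sqNorm (prodVec a b) = sqNorm a * sqNorm b := by
  simp only [sqNorm, prodVec, Fintype.sum_prod_type, norm_mul, mul_pow, Finset.sum_mul_sum]

/-- All squared overlaps of `φ` with product unit vectors are at most `g`, that is, the largest
Schmidt coefficient of `φ` is at most `g`. -/
def ProductOverlapLE {α β : Type*} [Fintype α] [Fintype β] (φ : α × β → ℂ) (g : ℝ) : Prop :=
  ∀ (a : α → ℂ) (b : β → ℂ), ‖star (prodVec a b) ⬝ᵥ φ‖ ^ 2 ≤ g * (sqNorm a * sqNorm b)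

theorem ProductOverlapLE.smul {α β : Type*} [Fintype α] [Fintype β] {φ : α × β → ℂ} {g : ℝ}
    (h : ProductOverlapLE φ g) (c : ℂ) : ProductOverlapLE (c • φ) (‖c‖ ^ 2 * g) := by
  intro a b
  rw [dotProduct_smul, smul_eq_mul, norm_mul, mul_pow, mul_assoc]
  exact mul_le_mul_of_nonneg_left (h a b) (by positivity)

/-! ### Spectrum of the reduced state -/

theorem reducedState_eq_mul {α β : Type*} [Fintype β] (ψ : α × β → ℂ) :
    reducedState ψ = (Matrix.of fun i k => ψ (i, k)) * (Matrix.of fun i k => ψ (i, k))ᴴ := by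
  ext i j
  simp [reducedState, Matrix.mul_apply]

open scoped ComplexOrder in
theorem eigenvalues_reducedState_nonneg {α β : Type*} [Fintype α] [DecidableEq α] [Fintype β]
    (ψ : α × β → ℂ) (i : α) : 0 ≤ (reducedState_isHermitian ψ).eigenvalues i := by
  have h : (reducedState ψ).PosSemidef := by
    rw [reducedState_eq_mul]
    exact Matrix.posSemidef_self_mul_conjTranspose _
  exact h.eigenvalues_nonneg i

theorem sum_eigenvalues_reducedState {α β : Type*} [Fintype α] [DecidableEq α] [Fintype β]
    (ψ : α × β → ℂ) : ∑ i, (reducedState_isHermitian ψ).eigenvalues i = sqNorm ψ := by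
  have h := (reducedState_isHermitian ψ).trace_eq_sum_eigenvalues
  have h2 : (reducedState ψ).trace = (sqNorm ψ : ℂ) := by
    simp [Matrix.trace, reducedState, sqNorm, Fintype.sum_prod_type, Complex.mul_conj']
  rw [h2] at h
  apply Complex.ofReal_injective
  rw [h, Complex.ofReal_sum]
  rfl

theorem ProductOverlapLE.eigenvalues_le {α β : Type*} [Fintype α] [DecidableEq α] [Fintype β]
    {ψ : α × β → ℂ} {g : ℝ} (hg : 0 ≤ g) (h : ProductOverlapLE ψ g) (i : α) :
    (reducedState_isHermitian ψ).eigenvalues i ≤ g := by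
  set hρ := reducedState_isHermitian ψ
  set M : Matrix α β ℂ := Matrix.of fun i k => ψ (i, k) with hM
  set v : α → ℂ := (hρ.eigenvectorBasis i).ofLp with hv
  have hv1 : sqNorm v = 1 := by
    have := (hρ.eigenvectorBasis).orthonormal.1 i
    rw [EuclideanSpace.norm_eq, Real.sqrt_eq_one] at this
    exact this
  have hlam : sqNorm (Mᴴ *ᵥ v) = hρ.eigenvalues i := by
    have h1 := hρ.eigenvalues_eq i
    have h2 : star v ⬝ᵥ (reducedState ψ) *ᵥ v = (sqNorm (Mᴴ *ᵥ v) : ℂ) := by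
      rw [← star_dotProduct_self, reducedState_eq_mul, ← Matrix.mulVec_mulVec,
        Matrix.dotProduct_mulVec, Matrix.star_mulVec, Matrix.conjTranspose_conjTranspose]
    rw [← hv, h2] at h1
    simpa using h1.symm
  -- The optimal test vector pairs the eigenvector `v` with the conjugate of `Mᴴ v`. Its overlap
  -- with `ψ` is the eigenvalue `λ`, so the hypothesis reads `λ² ≤ g λ`.
  have hov : star (prodVec v (star (Mᴴ *ᵥ v))) ⬝ᵥ ψ = (sqNorm (Mᴴ *ᵥ v) : ℂ) := by
    rw [← star_dotProduct_self]
    simp only [dotProduct, prodVec, Fintype.sum_prod_type, Pi.star_apply, star_mul', star_star]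
    rw [Finset.sum_comm]
    refine Finset.sum_congr rfl fun k _ => ?_
    rw [mul_comm (star ((Mᴴ *ᵥ v) k)), Matrix.mulVec, dotProduct, star_sum, Finset.mul_sum]
    refine Finset.sum_congr rfl fun j _ => ?_
    simp [hM]
    ring
  have h3 := h v (star (Mᴴ *ᵥ v))
  rw [hov, sqNorm_star, hv1, hlam, Complex.norm_real, Real.norm_eq_abs, sq_abs] at h3
  by_contra hlt
  push Not at hlt
  nlinarith

theorem one_le_entanglement {α β : Type*} [Fintype α] [DecidableEq α] [Fintype β]
    {ψ : α × β → ℂ} (hψ : IsPureState ψ) (h : ProductOverlapLE ψ (1 / 2)) :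
    1 ≤ entanglement ψ :=
  one_le_vonNeumannEntropy _ (eigenvalues_reducedState_nonneg ψ)
    ((sum_eigenvalues_reducedState ψ).trans hψ) (h.eigenvalues_le (by norm_num))

/-- The coefficient matrix factors through `ℂ²`, so the reduced state has rank at most two. -/
theorem entanglement_le_one {α β : Type*} [Fintype α] [DecidableEq α] [Fintype β]
    (a : Fin 2 → α → ℂ) (b : Fin 2 → β → ℂ) (h : IsPureState (∑ j, prodVec (a j) (b j))) :
    entanglement (∑ j, prodVec (a j) (b j)) ≤ 1 := by
  refine vonNeumannEntropy_le_one _ (eigenvalues_reducedState_nonneg _)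
    ((sum_eigenvalues_reducedState _).trans h) ?_
  have hM : (Matrix.of fun i k => (∑ j, prodVec (a j) (b j)) (i, k)) =
      (Matrix.of fun i j => a j i) * Matrix.of b := by
    ext i k
    simp [prodVec, Matrix.mul_apply]
  rw [reducedState_eq_mul, hM, Matrix.mul_assoc]
  exact (Matrix.rank_mul_le_left _ _).trans ((Matrix.rank_le_card_width _).trans (by simp))

/-- The vector `(|i⟩|k⟩ + |i'⟩|k'⟩) / √2`. -/
def bellState {α β : Type*} [DecidableEq α] [DecidableEq β] (i i' : α) (k k' : β) : α × β → ℂ :=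
  ((√2)⁻¹ : ℂ) • ∑ j : Fin 2, prodVec (Pi.single (![i, i'] j) 1) (Pi.single (![k, k'] j) 1)

theorem sqrt_two_inv_mul_self : ((√2)⁻¹ : ℂ) * ((√2)⁻¹ : ℂ) = 1 / 2 := by
  rw [← mul_inv, ← Complex.ofReal_mul, Real.mul_self_sqrt zero_le_two]
  norm_num

theorem norm_sqrt_two_inv_sq : ‖((√2)⁻¹ : ℂ)‖ ^ 2 = 1 / 2 := by
  rw [sq, ← norm_mul, sqrt_two_inv_mul_self]
  norm_num

theorem isPureState_bellState {α β : Type*} [Fintype α] [Fintype β] [DecidableEq α]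
    [DecidableEq β] {i i' : α} (k k' : β) (hi : i ≠ i') : IsPureState (bellState i i' k k') := by
  change sqNorm _ = 1
  rw [bellState, sqNorm_smul, norm_sqrt_two_inv_sq]
  have key : ∀ x : α × β, ‖(∑ j : Fin 2, prodVec (Pi.single (![i, i'] j) (1 : ℂ))
      (Pi.single (![k, k'] j) (1 : ℂ))) x‖ ^ 2 =
      (if x = (i, k) then 1 else 0) + (if x = (i', k') then 1 else 0) := by
    rintro ⟨x, y⟩
    simp only [Fin.sum_univ_two, prodVec, Pi.add_apply, Pi.single_apply, Prod.mk.injEq,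
      Matrix.cons_val_zero, Matrix.cons_val_one]
    by_cases h1 : x = i
    · subst h1
      by_cases h3 : y = k <;> simp [hi, h3]
    · by_cases h2 : x = i' <;> by_cases h4 : y = k' <;> simp [h1, h2, h4, hi.symm]
  simp only [sqNorm, key, Finset.sum_add_distrib]
  simp
  norm_num

theorem star_prodVec_dotProduct_prodVec {α β : Type*} [Fintype α] [Fintype β] (a c : α → ℂ)
    (b d : β → ℂ) : star (prodVec a b) ⬝ᵥ prodVec c d = (star a ⬝ᵥ c) * (star b ⬝ᵥ d) := by
  simp only [dotProduct, prodVec, Fintype.sum_prod_type, Finset.sum_mul_sum, Pi.star_apply,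
    star_mul']
  exact Finset.sum_congr rfl fun _ _ => Finset.sum_congr rfl fun _ _ => by ring

theorem sq_add_sq_le_sqNorm {α : Type*} [Fintype α] {i i' : α} (hi : i ≠ i') (a : α → ℂ) :
    ‖a i‖ ^ 2 + ‖a i'‖ ^ 2 ≤ sqNorm a := by
  classical
  rw [← Finset.sum_pair hi (f := fun i => ‖a i‖ ^ 2)]
  exact Finset.sum_le_sum_of_subset_of_nonneg (Finset.subset_univ _) fun _ _ _ => by positivity

theorem productOverlapLE_bellState {α β : Type*} [Fintype α] [Fintype β] [DecidableEq α]
    [DecidableEq β] {i i' : α} {k k' : β} (hi : i ≠ i') (hk : k ≠ k') :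
    ProductOverlapLE (bellState i i' k k') (1 / 2) := by
  intro a b
  have h1 : star (prodVec a b) ⬝ᵥ bellState i i' k k' =
      ((√2)⁻¹ : ℂ) * (star (a i) * star (b k) + star (a i') * star (b k')) := by
    simp [bellState, Fin.sum_univ_two, star_prodVec_dotProduct_prodVec, mul_add]
  rw [h1, norm_mul, mul_pow, norm_sqrt_two_inv_sq]
  refine mul_le_mul_of_nonneg_left ?_ (by norm_num)
  calc ‖star (a i) * star (b k) + star (a i') * star (b k')‖ ^ 2
      ≤ (‖a i‖ * ‖b k‖ + ‖a i'‖ * ‖b k'‖) ^ 2 := by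
        gcongr
        exact (norm_add_le _ _).trans (by simp)
    _ ≤ (‖a i‖ ^ 2 + ‖a i'‖ ^ 2) * (‖b k‖ ^ 2 + ‖b k'‖ ^ 2) := by
        nlinarith [sq_nonneg (‖a i‖ * ‖b k'‖ - ‖a i'‖ * ‖b k‖)]
    _ ≤ sqNorm a * sqNorm b := by
        gcongr
        · exact sqNorm_nonneg a
        · exact sq_add_sq_le_sqNorm hi a
        · exact sq_add_sq_le_sqNorm hk b

/-! ### Monotonicity of the largest Schmidt coefficient under LOCC -/

theorem star_dotProduct_eq_sum {ι κ : Type*} [Fintype ι] [DecidableEq ι] [Fintype κ]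
    {γ : κ → Type*} [∀ i, Fintype (γ i)] {L : (i : κ) → Matrix (γ i) ι ℂ}
    (hL : ∑ i, (L i)ᴴ * L i = 1) (u φ : ι → ℂ) :
    star u ⬝ᵥ φ = ∑ i, star (L i *ᵥ u) ⬝ᵥ (L i *ᵥ φ) := by
  conv_lhs => rw [← Matrix.one_mulVec φ, ← hL, Matrix.sum_mulVec, dotProduct_sum]
  refine Finset.sum_congr rfl fun i _ => ?_
  rw [Matrix.star_mulVec, ← Matrix.mulVec_mulVec, Matrix.dotProduct_mulVec]

theorem sum_sqNorm_mulVec {ι κ : Type*} [Fintype ι] [DecidableEq ι] [Fintype κ]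
    {γ : κ → Type*} [∀ i, Fintype (γ i)] {L : (i : κ) → Matrix (γ i) ι ℂ}
    (hL : ∑ i, (L i)ᴴ * L i = 1) (u : ι → ℂ) : ∑ i, sqNorm (L i *ᵥ u) = sqNorm u := by
  have h := star_dotProduct_eq_sum hL u u
  simp only [star_dotProduct_self] at h
  exact_mod_cast h.symm

theorem kronecker_mulVec_prodVec {α β γ δ : Type*} [Fintype α] [Fintype β] (A : Matrix γ α ℂ)
    (B : Matrix δ β ℂ) (a : α → ℂ) (b : β → ℂ) :
    (A ⊗ₖ B) *ᵥ prodVec a b = prodVec (A *ᵥ a) (B *ᵥ b) := by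
  ext ⟨i, k⟩
  simp only [Matrix.mulVec, dotProduct, prodVec, Matrix.kronecker_apply, Fintype.sum_prod_type,
    Finset.sum_mul_sum]
  exact Finset.sum_congr rfl fun _ _ => Finset.sum_congr rfl fun _ _ => by ring

/-- Triangle inequality, then Cauchy–Schwarz with weights `√(g i)` and `√(n i)`. -/
theorem norm_sum_sq_le {κ : Type*} [Fintype κ] {z : κ → ℂ} {g n : κ → ℝ} (hg : ∀ i, 0 ≤ g i)
    (hn : ∀ i, 0 ≤ n i) (h : ∀ i, ‖z i‖ ^ 2 ≤ g i * n i) :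
    ‖∑ i, z i‖ ^ 2 ≤ (∑ i, g i) * ∑ i, n i :=
  (pow_le_pow_left₀ (norm_nonneg _) (norm_sum_le _ _) 2).trans
    (Finset.sum_sq_le_sum_mul_sum_of_sq_le_mul _ (fun i _ => hg i) (fun i _ => hn i)
      fun i _ => h i)

/-- Inserting the completeness relation splits `⟨a ⊗ b, φ⟩` into the overlaps of `K i a ⊗ b` with
the branches `(K i ⊗ 1) φ`. A local operation keeps the test vector a product, and the squared norms
of the `K i a` add up to that of `a`, so Cauchy–Schwarz adds the branch bounds. The branches are not
normalised: their probabilities are absorbed in `g i`. -/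
theorem ProductOverlapLE.sum_left {α β κ : Type*} [Fintype α] [DecidableEq α] [Fintype β]
    [DecidableEq β] [Fintype κ] {γ : κ → Type*} [∀ i, Fintype (γ i)]
    {K : (i : κ) → Matrix (γ i) α ℂ} (hK : ∑ i, (K i)ᴴ * K i = 1) {φ : α × β → ℂ} {g : κ → ℝ}
    (hg : ∀ i, 0 ≤ g i)
    (h : ∀ i, ProductOverlapLE ((K i ⊗ₖ (1 : Matrix β β ℂ)) *ᵥ φ) (g i)) :
    ProductOverlapLE φ (∑ i, g i) := by
  intro a b
  have hL : ∑ i, (K i ⊗ₖ (1 : Matrix β β ℂ))ᴴ * (K i ⊗ₖ (1 : Matrix β β ℂ)) = 1 := by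
    simp only [Matrix.conjTranspose_kronecker, ← Matrix.mul_kronecker_mul,
      Matrix.conjTranspose_one, mul_one]
    rw [← Matrix.one_kronecker_one, ← hK]
    ext ⟨i, k⟩ ⟨j, l⟩
    simp [Matrix.sum_apply, Finset.sum_mul]
  rw [star_dotProduct_eq_sum (γ := fun i => γ i × β) hL, ← sum_sqNorm_mulVec hK a,
    mul_comm (∑ i, sqNorm _), Finset.mul_sum]
  refine norm_sum_sq_le hg (fun i => mul_nonneg (sqNorm_nonneg b) (sqNorm_nonneg (K i *ᵥ a)))
    fun i => ?_
  rw [mul_comm (sqNorm b), kronecker_mulVec_prodVec, Matrix.one_mulVec]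
  exact h i _ b

theorem ProductOverlapLE.sum_right {α β κ : Type*} [Fintype α] [DecidableEq α] [Fintype β]
    [DecidableEq β] [Fintype κ] {γ : κ → Type*} [∀ i, Fintype (γ i)]
    {K : (i : κ) → Matrix (γ i) β ℂ} (hK : ∑ i, (K i)ᴴ * K i = 1) {φ : α × β → ℂ} {g : κ → ℝ}
    (hg : ∀ i, 0 ≤ g i)
    (h : ∀ i, ProductOverlapLE (((1 : Matrix α α ℂ) ⊗ₖ K i) *ᵥ φ) (g i)) :
    ProductOverlapLE φ (∑ i, g i) := by
  intro a b
  have hL : ∑ i, ((1 : Matrix α α ℂ) ⊗ₖ K i)ᴴ * ((1 : Matrix α α ℂ) ⊗ₖ K i) = 1 := by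
    simp only [Matrix.conjTranspose_kronecker, ← Matrix.mul_kronecker_mul,
      Matrix.conjTranspose_one, mul_one]
    rw [← Matrix.one_kronecker_one, ← hK]
    ext ⟨i, k⟩ ⟨j, l⟩
    simp [Matrix.sum_apply, Finset.mul_sum]
  rw [star_dotProduct_eq_sum (γ := fun i => α × γ i) hL, ← sum_sqNorm_mulVec hK b, Finset.mul_sum]
  refine norm_sum_sq_le hg (fun i => mul_nonneg (sqNorm_nonneg _) (sqNorm_nonneg _)) fun i => ?_
  rw [kronecker_mulVec_prodVec, Matrix.one_mulVec]
  exact h i a _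

/-- The operator `|φ⟩⟨φ|`. -/
def rankOne {ι : Type*} (φ : ι → ℂ) : Matrix ι ι ℂ := Matrix.vecMulVec φ (star φ)

theorem mul_rankOne_mul {ι κ : Type*} [Fintype ι] (L : Matrix κ ι ℂ) (φ : ι → ℂ) :
    L * rankOne φ * Lᴴ = rankOne (L *ᵥ φ) := by
  rw [rankOne, rankOne, Matrix.mul_vecMulVec, Matrix.vecMulVec_mul, Matrix.star_mulVec]

/-- A Kraus operator maps a pure state to a pure one, so each leaf of the tree carries a single
unnormalised vector. Bounds at the leaves are pulled back to the root one measurement at a time. -/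
theorem LOCC.exists_pure_decomposition {a' b' a b : ℕ} (P : LOCC a' b' a b)
    (φ : Fin a × Fin b → ℂ) :
    ∃ (κ : Type) (_ : Fintype κ) (v : κ → Fin a' × Fin b' → ℂ),
      P.channel (rankOne φ) = ∑ p, rankOne (v p) ∧
      ∀ g : κ → ℝ, (∀ p, 0 ≤ g p) → (∀ p, ProductOverlapLE (v p) (g p)) →
        ProductOverlapLE φ (∑ p, g p) := by
  induction P with
  | halt =>
    refine ⟨Unit, inferInstance, fun _ => φ, by simp [LOCC.channel], fun g _ h => ?_⟩
    simpa using h ()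
  | alice k c K hK next ih =>
    choose κ hκ v hv hg using fun i => ih i ((K i ⊗ₖ (1 : Matrix _ _ ℂ)) *ᵥ φ)
    refine ⟨Σ i, κ i, inferInstance, fun p => v p.1 p.2, ?_, fun g hg0 h => ?_⟩
    · simp only [LOCC.channel, mul_rankOne_mul, hv, Fintype.sum_sigma]
    · rw [Fintype.sum_sigma]
      exact ProductOverlapLE.sum_left hK (fun i => Finset.sum_nonneg fun p _ => hg0 ⟨i, p⟩)
        fun i => hg i _ (fun p => hg0 ⟨i, p⟩) fun p => h ⟨i, p⟩
  | bob k c K hK next ih =>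
    choose κ hκ v hv hg using fun i => ih i (((1 : Matrix _ _ ℂ) ⊗ₖ K i) *ᵥ φ)
    refine ⟨Σ i, κ i, inferInstance, fun p => v p.1 p.2, ?_, fun g hg0 h => ?_⟩
    · simp only [LOCC.channel, mul_rankOne_mul, hv, Fintype.sum_sigma]
    · rw [Fintype.sum_sigma]
      exact ProductOverlapLE.sum_right hK (fun i => Finset.sum_nonneg fun p _ => hg0 ⟨i, p⟩)
        fun i => hg i _ (fun p => hg0 ⟨i, p⟩) fun p => h ⟨i, p⟩

/-! ### Extremality of pure states and exact transformations -/

theorem star_dotProduct_rankOne_mulVec {ι : Type*} [Fintype ι] (w v : ι → ℂ) :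
    star w ⬝ᵥ (rankOne v *ᵥ w) = ((‖star w ⬝ᵥ v‖ ^ 2 : ℝ) : ℂ) := by
  have h : star v ⬝ᵥ w = star (star w ⬝ᵥ v) := by
    rw [Matrix.star_dotProduct, dotProduct_comm]
  rw [rankOne, Matrix.vecMulVec_mulVec, h]
  simp [Complex.conj_mul']

/-- If a rank one projection is a sum of rank one operators, then these are proportional to it. -/
theorem exists_smul_of_sum_rankOne_eq {ι κ : Type*} [Fintype ι] [Fintype κ] {χ : ι → ℂ}
    (hχ : IsPureState χ) {v : κ → ι → ℂ} (h : ∑ p, rankOne (v p) = rankOne χ) :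
    ∃ c : κ → ℂ, (∀ p, v p = c p • χ) ∧ ∑ p, ‖c p‖ ^ 2 = 1 := by
  have hχχ : star χ ⬝ᵥ χ = 1 := by
    rw [star_dotProduct_self, show sqNorm χ = 1 from hχ, Complex.ofReal_one]
  have key : ∀ w : ι → ℂ, ∑ p, ‖star w ⬝ᵥ v p‖ ^ 2 = ‖star w ⬝ᵥ χ‖ ^ 2 := by
    intro w
    have := congrArg (fun M => star w ⬝ᵥ (M *ᵥ w)) h
    simp only [Matrix.sum_mulVec, dotProduct_sum, star_dotProduct_rankOne_mulVec] at this
    exact_mod_cast this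
  refine ⟨fun p => star χ ⬝ᵥ v p, fun p => ?_, by rw [key, hχχ]; simp⟩
  -- `w` is the part of `v p` orthogonal to `χ`. Evaluating both sides of the identity at `w` gives
  -- zero on the right, hence `⟨w, v p⟩ = 0`, which forces `‖w‖² = 0`.
  set w := v p - (star χ ⬝ᵥ v p) • χ with hw
  have hwχ' : star χ ⬝ᵥ w = 0 := by
    rw [hw, dotProduct_sub, dotProduct_smul, hχχ, smul_eq_mul, mul_one, sub_self]
  have hwχ : star w ⬝ᵥ χ = 0 := by
    rw [Matrix.star_dotProduct, hwχ', star_zero]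
  have h0 := key w
  rw [hwχ, norm_zero, zero_pow two_ne_zero,
    Finset.sum_eq_zero_iff_of_nonneg fun _ _ => by positivity] at h0
  have h1 : star w ⬝ᵥ v p = 0 := by simpa using h0 p (Finset.mem_univ p)
  have h2 : star w ⬝ᵥ w = 0 := by
    conv_lhs => rw [hw]
    rw [← hw, dotProduct_sub, dotProduct_smul, hwχ, h1, smul_zero, sub_zero]
  rw [star_dotProduct_self] at h2
  exact sub_eq_zero.1 (eq_zero_of_sqNorm_eq_zero (by exact_mod_cast h2))

/-- A pure final state leaves no freedom: every leaf is `c p • χ` with `∑ ‖c p‖² = 1`, so the leaf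
bounds `‖c p‖² g` add up to exactly `g`. -/
theorem LOCC.productOverlapLE_of_channel_eq {a' b' a b : ℕ} (P : LOCC a' b' a b)
    {φ : Fin a × Fin b → ℂ} {χ : Fin a' × Fin b' → ℂ} (hχ : IsPureState χ)
    (h : P.channel (rankOne φ) = rankOne χ) {g : ℝ} (hg : 0 ≤ g) (hχg : ProductOverlapLE χ g) :
    ProductOverlapLE φ g := by
  obtain ⟨κ, _, v, hv, hb⟩ := P.exists_pure_decomposition φ
  obtain ⟨c, hc, hsum⟩ := exists_smul_of_sum_rankOne_eq hχ (hv.symm.trans h)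
  have := hb (fun p => ‖c p‖ ^ 2 * g) (fun p => by positivity) fun p => by
    rw [hc p]
    exact hχg.smul (c p)
  rwa [← Finset.sum_mul, hsum, one_mul] at this

/-- The vector `|u⟩_{AB}|ψ⟩_{A'B'}` across the cut `AA' : BB'`. -/
def withResourceVec {dA dB m n : ℕ} (u : Fin dA × Fin dB → ℂ) (ψ : Fin m × Fin n → ℂ) :
    Fin (dA * m) × Fin (dB * n) → ℂ := fun x =>
  u ((finProdFinEquiv.symm x.1).1, (finProdFinEquiv.symm x.2).1) *
    ψ ((finProdFinEquiv.symm x.1).2, (finProdFinEquiv.symm x.2).2)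

theorem withResource_rankOne {dA dB m n : ℕ} (u : Fin dA × Fin dB → ℂ) (ψ : Fin m × Fin n → ℂ) :
    withResource (rankOne u) ψ = rankOne (withResourceVec u ψ) := by
  ext x y
  simp [withResource, rankOne, withResourceVec, Matrix.vecMulVec_apply, Equiv.prodProdProdComm]
  ring

theorem ProductOverlapLE.of_withResourceVec {dA dB m n : ℕ} {a : Fin dA → ℂ} {b : Fin dB → ℂ}
    (ha : IsPureState a) (hb : IsPureState b) {ψ : Fin m × Fin n → ℂ} {g : ℝ}
    (h : ProductOverlapLE (withResourceVec (prodVec a b) ψ) g) : ProductOverlapLE ψ g := by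
  intro c d
  have hnorm : ∀ {k l : ℕ} (a : Fin k → ℂ) (c : Fin l → ℂ),
      sqNorm (fun i => prodVec a c (finProdFinEquiv.symm i)) = sqNorm a * sqNorm c := by
    intro k l a c
    rw [← sqNorm_prodVec, sqNorm, sqNorm]
    exact finProdFinEquiv.symm.sum_comp fun i => ‖prodVec a c i‖ ^ 2
  -- Testing with `(a ⊗ c) ⊗ (b ⊗ d)` makes the overlap factor, and the input part contributes 1.
  have hov : star (prodVec (fun i => prodVec a c (finProdFinEquiv.symm i))
      (fun i => prodVec b d (finProdFinEquiv.symm i))) ⬝ᵥ withResourceVec (prodVec a b) ψ =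
      star (prodVec a b) ⬝ᵥ prodVec a b * (star (prodVec c d) ⬝ᵥ ψ) := by
    simp only [dotProduct]
    rw [← (Equiv.prodCongr finProdFinEquiv finProdFinEquiv).sum_comp]
    rw [← (Equiv.prodProdProdComm (Fin dA) (Fin dB) (Fin m) (Fin n)).sum_comp]
    simp only [Fintype.sum_prod_type (α₁ := Fin dA × Fin dB), Finset.sum_mul_sum]
    refine Finset.sum_congr rfl fun x _ => Finset.sum_congr rfl fun y _ => ?_
    simp [prodVec, withResourceVec, Equiv.prodProdProdComm, -finProdFinEquiv_symm_apply]
    ring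
  have h1 := h (fun i => prodVec a c (finProdFinEquiv.symm i))
    (fun i => prodVec b d (finProdFinEquiv.symm i))
  rw [hov, star_dotProduct_self, hnorm, hnorm, sqNorm_prodVec, show sqNorm a = 1 from ha,
    show sqNorm b = 1 from hb] at h1
  simpa using h1

/-! ### Permutation unitaries of Schmidt rank two -/

section ZeroOne
variable {ι : Type*} [Fintype ι] [DecidableEq ι] {U : Matrix ι ι ℂ}

theorem IsPermutationUnitary.exists_row (hU : IsPermutationUnitary U) :
    ∃ f : ι → ι, ∀ i j, U i j = if j = f i then 1 else 0 := by
  have h : ∀ i, ∃! j, U i j = 1 := by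
    intro i
    -- For entries 0 and 1 this diagonal entry counts the ones in row `i`.
    have h1 : (U * star U) i i = 1 := by rw [Unitary.mul_star_self_of_mem hU.1, Matrix.one_apply_eq]
    have h2 : ∀ j, U i j * star (U i j) = if U i j = 1 then 1 else 0 := by
      intro j
      rcases hU.2 i j with h | h <;> simp [h]
    simp only [Matrix.mul_apply, Matrix.star_apply, h2, Finset.sum_boole] at h1
    have h3 : (Finset.univ.filter fun j => U i j = 1).card = 1 := by exact_mod_cast h1
    obtain ⟨j, hj⟩ := Finset.card_eq_one.1 h3
    refine ⟨j, ?_, fun k hk => ?_⟩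
    · have : j ∈ Finset.univ.filter fun j => U i j = 1 := by simp [hj]
      simpa using this
    · have : k ∈ Finset.univ.filter fun j => U i j = 1 := by simpa using hk
      simpa [hj] using this
  choose f hf hf' using h
  refine ⟨f, fun i j => ?_⟩
  split_ifs with hj
  · rw [hj]; exact hf i
  · exact (hU.2 i j).resolve_right fun h => hj (hf' i j h)

theorem IsPermutationUnitary.transpose (hU : IsPermutationUnitary U) :
    IsPermutationUnitary Uᵀ :=
  ⟨Matrix.transpose_mem_unitaryGroup_iff.2 hU.1, fun i j => hU.2 j i⟩

end ZeroOne

theorem exists_minor_ne_zero {m n : Type*} {S : Fin 2 → Matrix m n ℂ}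
    (hS : LinearIndependent ℂ S) : ∃ a b c d, S 0 a b * S 1 c d - S 1 a b * S 0 c d ≠ 0 := by
  by_contra! h
  have h0 : S 0 ≠ 0 := hS.ne_zero 0
  obtain ⟨a, b, hz⟩ : ∃ a b, S 0 a b ≠ 0 := by
    by_contra! h1
    exact h0 (Matrix.ext h1)
  -- If all minors vanish, `S 0 a b • S 1 - S 1 a b • S 0 = 0` is a nontrivial linear relation.
  refine hz (Fintype.linearIndependent_iff.1 hS ![-S 1 a b, S 0 a b] ?_ 1)
  ext c d
  simp only [Fin.sum_univ_two, Matrix.cons_val_zero, Matrix.cons_val_one, Matrix.add_apply,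
    Matrix.smul_apply, smul_eq_mul, Matrix.zero_apply]
  linear_combination h a b c d

/-- The realignment of a permutation unitary of Schmidt rank two has an identity minor. -/
theorem IsPermutationUnitary.exists_identity_minor {dA dB : ℕ}
    {U : Matrix (Fin dA × Fin dB) (Fin dA × Fin dB) ℂ}
    (hU : IsPermutationUnitary U) (hr : HasSchmidtRank U 2) :
    ∃ i j i' j' k l k' l', U (i, k) (j, l) = 1 ∧ U (i, k') (j, l') = 0 ∧
      U (i', k) (j', l) = 0 ∧ U (i', k') (j', l') = 1 := by
  obtain ⟨f, hf⟩ := hU.exists_row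
  obtain ⟨S, T, hS, hT, rfl⟩ := hr
  set U := ∑ j, S j ⊗ₖ T j with hUdef
  by_contra! hno
  -- Without an identity minor, the first component of `f` depends only on `i` and, by `h2`, the
  -- second only on `k`.
  have h1 : ∀ i k k', (f (i, k)).1 = (f (i, k')).1 := by
    intro i k k'
    by_contra hne
    refine hno i (f (i, k)).1 i (f (i, k')).1 k (f (i, k)).2 k' (f (i, k')).2 (by simp [hf]) ?_ ?_
      (by simp [hf])
    · exact (hf _ _).trans (ite_eq_right_iff.2 fun h => absurd (Prod.ext_iff.1 h).1 hne)
    · exact (hf _ _).trans (ite_eq_right_iff.2 fun h => absurd (Prod.ext_iff.1 h).1.symm hne)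
  have h2 : ∀ i i' k, (f (i, k)).2 = (f (i', k)).2 := by
    intro i i' k
    by_contra hne
    refine hno i (f (i, k)).1 i' (f (i', k)).1 k (f (i, k)).2 k (f (i', k)).2 (by simp [hf]) ?_ ?_
      (by simp [hf])
    · exact (hf _ _).trans (ite_eq_right_iff.2 fun h => absurd (Prod.ext_iff.1 h).2.symm hne)
    · exact (hf _ _).trans (ite_eq_right_iff.2 fun h => absurd (Prod.ext_iff.1 h).2 hne)
  obtain ⟨a, b, c, d, hSn⟩ := exists_minor_ne_zero hS
  obtain ⟨a', b', c', d', hTn⟩ := exists_minor_ne_zero hT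
  have hprod : U (a, a') (b, b') * U (c, c') (d, d') = U (a, c') (b, d') * U (c, a') (d, b') := by
    simp only [hf, ← ite_and, mul_ite, mul_one, mul_zero, Prod.ext_iff]
    rw [h1 a c' a', h1 c c' a', h2 c a a', h2 c a c']
    refine if_congr ?_ rfl rfl
    tauto
  have hent : ∀ i j k l, U (i, k) (j, l) = S 0 i j * T 0 k l + S 1 i j * T 1 k l := by
    intro i j k l
    rw [hUdef, Fin.sum_univ_two]
    rfl
  -- Cauchy–Binet: the 2×2 minor of the realignment is the product of a minor of `S` and a minor of
  -- `T`, while `hprod` says that it vanishes.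
  refine mul_ne_zero hSn hTn ?_
  simp only [hent] at hprod
  linear_combination hprod

/-- Skeleton decomposition: an operator of Schmidt rank two is determined by two rows and two
columns of its realignment. -/
theorem HasSchmidtRank.eq_of_identity_minor {dA dB : ℕ}
    {U : Matrix (Fin dA × Fin dB) (Fin dA × Fin dB) ℂ} (hr : HasSchmidtRank U 2)
    {i j i' j' : Fin dA} {k l k' l' : Fin dB} (h1 : U (i, k) (j, l) = 1)
    (h2 : U (i, k') (j, l') = 0) (h3 : U (i', k) (j', l) = 0) (h4 : U (i', k') (j', l') = 1) :
    U = (Matrix.of fun a b => U (a, k) (b, l)) ⊗ₖ (Matrix.of fun c d => U (i, c) (j, d)) +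
      (Matrix.of fun a b => U (a, k') (b, l')) ⊗ₖ (Matrix.of fun c d => U (i', c) (j', d)) := by
  obtain ⟨S, T, -, -, hST⟩ := hr
  have hent : ∀ i j k l, U (i, k) (j, l) = S 0 i j * T 0 k l + S 1 i j * T 1 k l := by
    intro i j k l
    rw [hST, Fin.sum_univ_two]
    rfl
  ext ⟨a, c⟩ ⟨b, d⟩
  -- The 3×3 minor of the realignment on rows `(i,j)`, `(i',j')`, `(a,b)` and columns `(k,l)`,
  -- `(k',l')`, `(c,d)`; it vanishes because the realignment has rank at most two.
  have hdet : U (i, k) (j, l) * U (i', k') (j', l') * U (a, c) (b, d)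
      - U (i, k) (j, l) * U (i', c) (j', d) * U (a, k') (b, l')
      - U (i, k') (j, l') * U (i', k) (j', l) * U (a, c) (b, d)
      + U (i, k') (j, l') * U (i', c) (j', d) * U (a, k) (b, l)
      + U (i, c) (j, d) * U (i', k) (j', l) * U (a, k') (b, l')
      - U (i, c) (j, d) * U (i', k') (j', l') * U (a, k) (b, l) = 0 := by
    simp only [hent]
    ring
  rw [h1, h2, h3, h4] at hdet
  simp only [Matrix.add_apply, Matrix.kronecker_apply, Matrix.of_apply]
  linear_combination hdet

/-- A matrix with entries `0` and `1` and at most one `1` in each row and column. -/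
structure IsPartialPermutation {α : Type*} (A : Matrix α α ℂ) : Prop where
  zero_or_one : ∀ i j, A i j = 0 ∨ A i j = 1
  row : ∀ {i j j'}, A i j = 1 → A i j' = 1 → j = j'
  col : ∀ {i i' j}, A i j = 1 → A i' j = 1 → i = i'

theorem IsPermutationUnitary.isPartialPermutation {ι : Type*} [Fintype ι] [DecidableEq ι]
    {U : Matrix ι ι ℂ} (hU : IsPermutationUnitary U) : IsPartialPermutation U := by
  obtain ⟨f, hf⟩ := hU.exists_row
  obtain ⟨g, hg⟩ := hU.transpose.exists_row
  refine ⟨hU.2, fun {i j j'} h h' => ?_, fun {i i' j} h h' => ?_⟩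
  · rw [hf] at h h'
    simp only [ite_eq_left_iff, zero_ne_one, imp_false, not_not] at h h'
    exact h.trans h'.symm
  · rw [← Matrix.transpose_apply U, hg] at h h'
    simp only [ite_eq_left_iff, zero_ne_one, imp_false, not_not] at h h'
    exact h.trans h'.symm

/-! ### Supports of partial permutations -/

namespace IsPartialPermutation

variable {α : Type*} {A B : Matrix α α ℂ}

theorem transpose (hA : IsPartialPermutation A) : IsPartialPermutation Aᵀ :=
  ⟨fun i j => hA.1 j i, hA.col, hA.row⟩

/-- With no empty row, the positions of the ones define an injection of a finite set into itself,
hence a surjection. -/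
theorem col_ne_of_row_ne [Finite α] (hA : IsPartialPermutation A) (h : ∀ i, ∃ j, A i j = 1)
    (j : α) : ∃ i, A i j = 1 := by
  choose f hf using h
  obtain ⟨i, rfl⟩ := Finite.injective_iff_surjective.1
    (fun i i' hi => hA.col (hf i) (hi ▸ hf i') : Function.Injective f) j
  exact ⟨i, hf i⟩

open scoped Classical in
theorem conjTranspose_mul_self [Fintype α] [DecidableEq α] (hA : IsPartialPermutation A) :
    Aᴴ * A = Matrix.diagonal fun j => if ∃ i, A i j = 1 then 1 else 0 := by
  ext j j'
  simp only [Matrix.mul_apply, Matrix.conjTranspose_apply, Matrix.diagonal_apply]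
  by_cases h : ∃ i, A i j = 1
  · obtain ⟨i, hi⟩ := h
    rw [Finset.sum_eq_single i, hi, star_one, one_mul]
    · simp only [if_pos (show ∃ i, A i j = 1 from ⟨i, hi⟩)]
      split_ifs with hj
      · rw [← hj, hi]
      · exact (hA.1 i j').resolve_right fun h => hj (hA.row hi h)
    · intro i' _ hne
      rw [(hA.1 i' j).resolve_right fun h => hne (hA.col h hi), star_zero, zero_mul]
    · simp
  · rw [if_neg h, ite_self]
    refine Finset.sum_eq_zero fun i _ => ?_
    rw [(hA.1 i j).resolve_right fun hi => h ⟨i, hi⟩, star_zero, zero_mul]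

theorem conjTranspose_eq (hA : IsPartialPermutation A) : Aᴴ = Aᵀ := by
  ext i j
  rcases hA.1 j i with h | h <;> simp [h]

theorem conjTranspose_mul_self_add [Fintype α] [DecidableEq α] (hA : IsPartialPermutation A)
    (hB : IsPartialPermutation B) (h : ∀ j, (∃ i, A i j = 1) ↔ ¬ ∃ i, B i j = 1) :
    Aᴴ * A + Bᴴ * B = 1 := by
  classical
  rw [hA.conjTranspose_mul_self, hB.conjTranspose_mul_self, Matrix.diagonal_add,
    ← Matrix.diagonal_one]
  congr 1
  ext j
  by_cases hj : ∃ i, B i j = 1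
  · rw [if_neg fun h' => (h j).1 h' hj, if_pos hj, zero_add]
  · rw [if_pos ((h j).2 hj), if_neg hj, add_zero]

theorem conjTranspose_mul_eq_zero [Fintype α] (hA : IsPartialPermutation A)
    (hB : IsPartialPermutation B) (h : ∀ i, (∃ j, A i j = 1) ↔ ¬ ∃ j, B i j = 1) :
    Aᴴ * B = 0 := by
  ext j j'
  rw [Matrix.mul_apply, Matrix.zero_apply]
  refine Finset.sum_eq_zero fun i _ => ?_
  rw [Matrix.conjTranspose_apply]
  rcases hA.1 i j with h0 | h1
  · rw [h0, star_zero, zero_mul]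
  · rw [(hB.1 i j').resolve_right fun h' => (h i).1 ⟨j, h1⟩ ⟨j', h'⟩, mul_zero]

end IsPartialPermutation

/-- `P` and `Q` are partial isometries with orthogonal initial and final spaces that add up to the
whole space; `V` and `W` are isometries. -/
structure IsControlPair {α β : Type*} [Fintype α] [DecidableEq α] [Fintype β] [DecidableEq β]
    (P Q : Matrix α α ℂ) (V W : Matrix β β ℂ) : Prop where
  initial_add : Pᴴ * P + Qᴴ * Q = 1
  initial_orth : Pᴴ * Q = 0
  final_add : P * Pᴴ + Q * Qᴴ = 1
  final_orth : P * Qᴴ = 0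
  isometry_left : Vᴴ * V = 1
  isometry_right : Wᴴ * W = 1

/-- `U` is a controlled permutation `P ⊗ V + Q ⊗ W` that sends two basis vectors with the same
second component to basis vectors that differ in both components. -/
def IsControlledPermutation {α β : Type*} [Fintype α] [DecidableEq α] [Fintype β] [DecidableEq β]
    (U : Matrix (α × β) (α × β) ℂ) : Prop :=
  (∃ P Q V W, IsControlPair P Q V W ∧ U = P ⊗ₖ V + Q ⊗ₖ W) ∧
    ∃ i i' j j' k k' l, i ≠ i' ∧ j ≠ j' ∧ k ≠ k' ∧ U (i, k) (j, l) = 1 ∧ U (i', k') (j', l) = 1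

section Control

variable {α β : Type*} {A B : Matrix α α ℂ} {X Y : Matrix β β ℂ}

theorem isControlledPermutation_of_partial [Fintype α] [DecidableEq α] [Fintype β]
    [DecidableEq β] (hA : IsPartialPermutation A) (hB : IsPartialPermutation B)
    (hX : IsPartialPermutation X) (hY : IsPartialPermutation Y)
    (hrow : ∀ i, (∃ j, A i j = 1) ↔ ¬ ∃ j, B i j = 1)
    (hcol : ∀ j, (∃ i, A i j = 1) ↔ ¬ ∃ i, B i j = 1)
    (hXcol : ∀ l, ∃ k, X k l = 1) (hYcol : ∀ l, ∃ k, Y k l = 1)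
    {i j i' j' : α} {k l : β} (hij : A i j = 1) (hij' : B i' j' = 1) (hkl : X k l = 1)
    (hkl' : Y k l = 0) : IsControlledPermutation (A ⊗ₖ X + B ⊗ₖ Y) := by
  classical
  -- The conditions on final spaces are those on initial spaces for the transposes, with rows and
  -- columns exchanged.
  have hfa := hA.transpose.conjTranspose_mul_self_add hB.transpose hrow
  have hfo := hA.transpose.conjTranspose_mul_eq_zero hB.transpose hcol
  rw [hA.transpose.conjTranspose_eq, hB.transpose.conjTranspose_eq, Matrix.transpose_transpose,
    Matrix.transpose_transpose, ← hA.conjTranspose_eq, ← hB.conjTranspose_eq] at hfa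
  rw [hA.transpose.conjTranspose_eq, Matrix.transpose_transpose, ← hB.conjTranspose_eq] at hfo
  refine ⟨⟨A, B, X, Y, ⟨hA.conjTranspose_mul_self_add hB hcol,
    hA.conjTranspose_mul_eq_zero hB hrow, hfa, hfo, ?_, ?_⟩, rfl⟩, ?_⟩
  · simp [hX.conjTranspose_mul_self, hXcol]
  · simp [hY.conjTranspose_mul_self, hYcol]
  -- `X` sends `l` to `k`, whereas `Y` sends it to some `k'`, which differs from `k` because `Y k l
  -- = 0`.
  · obtain ⟨k', hk'⟩ := hYcol l
    have hA' : A i' j' = 0 := (hA.1 _ _).resolve_right fun h => (hrow i').1 ⟨_, h⟩ ⟨_, hij'⟩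
    refine ⟨i, i', j, j', k, k', l, ?_, ?_, ?_, ?_, ?_⟩
    · rintro rfl
      exact (hrow i).1 ⟨_, hij⟩ ⟨_, hij'⟩
    · rintro rfl
      exact (hcol j).1 ⟨_, hij⟩ ⟨_, hij'⟩
    · rintro rfl
      exact zero_ne_one (hkl'.symm.trans hk')
    · simp [hij, hkl, hkl']
    · simp [hA', hij', hk']

/-- Row `(a, c)` of a permutation matrix has exactly one 1. If both terms met this row, their ones
would have to fall on the same position, where the entry would be 2; if neither did, the row would
vanish. -/
theorem row_xor [Fintype α] [DecidableEq α] [Fintype β] [DecidableEq β]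
    (hU : IsPermutationUnitary (A ⊗ₖ X + B ⊗ₖ Y))
    (hA : IsPartialPermutation A) (hB : IsPartialPermutation B)
    (hX : IsPartialPermutation X) (hY : IsPartialPermutation Y) (a : α) (c : β) :
    ((∃ b, A a b = 1) ∧ ∃ d, X c d = 1) ↔ ¬ ((∃ b, B a b = 1) ∧ ∃ d, Y c d = 1) := by
  obtain ⟨f, hf⟩ := hU.exists_row
  constructor
  · rintro ⟨⟨b, hb⟩, d, hd⟩ ⟨⟨b', hb'⟩, d', hd'⟩
    have e1 : A a b * X c d + B a b * Y c d = 0 ∨ A a b * X c d + B a b * Y c d = 1 :=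
      hU.2 (a, c) (b, d)
    have e2 : A a b' * X c d' + B a b' * Y c d' = 0 ∨ A a b' * X c d' + B a b' * Y c d' = 1 :=
      hU.2 (a, c) (b', d')
    have u1 : A a b * X c d + B a b * Y c d = 1 := by
      rcases hB.1 a b with h | h <;> rcases hY.1 c d with h' | h' <;>
        simp only [hb, hd, h, h'] at e1 ⊢ <;>
        first | (norm_num; done) | norm_num at e1
    have u2 : A a b' * X c d' + B a b' * Y c d' = 1 := by
      rcases hA.1 a b' with h | h <;> rcases hX.1 c d' with h' | h' <;>
        simp only [hb', hd', h, h'] at e2 ⊢ <;>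
        first | (norm_num; done) | norm_num at e2
    obtain ⟨rfl, rfl⟩ := Prod.mk.inj (hU.isPartialPermutation.row (i := (a, c)) (j := (b, d))
      (j' := (b', d')) u1 u2)
    rw [hb, hd, hb', hd'] at u1
    norm_num at u1
  · intro h
    have h1 : A a (f (a, c)).1 * X c (f (a, c)).2 + B a (f (a, c)).1 * Y c (f (a, c)).2 = 1 := by
      have := hf (a, c) (f (a, c))
      rwa [if_pos rfl] at this
    have h0 : B a (f (a, c)).1 * Y c (f (a, c)).2 = 0 := by
      rcases hB.1 a (f (a, c)).1 with hb | hb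
      · rw [hb, zero_mul]
      · rw [(hY.1 c (f (a, c)).2).resolve_right fun hy => h ⟨⟨_, hb⟩, _, hy⟩, mul_zero]
    rw [h0, add_zero] at h1
    refine ⟨⟨(f (a, c)).1, (hA.1 _ _).resolve_left fun h => ?_⟩, (f (a, c)).2,
      (hX.1 _ _).resolve_left fun h => ?_⟩ <;> simp [h] at h1

/-- The rectangles `RA × RX` and `RB × RY` are nonempty and partition the whole rectangle, so they
are separated by a horizontal or a vertical line. -/
theorem forall_or_forall_of_xor {RA RB : α → Prop} {RX RY : β → Prop}
    (h : ∀ a c, (RA a ∧ RX c) ↔ ¬ (RB a ∧ RY c)) {i i' : α} {k k' : β} (hA : RA i) (hB : RB i')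
    (hX : RX k) (hY : RY k') :
    ((∀ c, RX c) ∧ (∀ c, RY c) ∧ ∀ a, RA a ↔ ¬ RB a) ∨
      ((∀ a, RA a) ∧ (∀ a, RB a) ∧ ∀ c, RX c ↔ ¬ RY c) := by
  by_cases hi : RB i
  · have hk : ¬ RY k := fun hk => (h i k).1 ⟨hA, hX⟩ ⟨hi, hk⟩
    have hA' : ∀ a, RA a := fun a => ((h a k).2 fun h' => hk h'.2).1
    have hB' : ∀ a, RB a := by
      intro a
      by_contra ha
      have := h a k'
      have := h i' k'
      have := hA' i'
      tauto
    exact Or.inr ⟨hA', hB', fun c => by simpa [hA' i, hB' i] using h i c⟩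
  · have hX' : ∀ c, RX c := fun c => ((h i c).2 fun h' => hi h'.1).2
    have hY' : ∀ c, RY c := by
      intro c
      by_contra hc
      have h1 := h i' c
      have h2 := h i' k'
      have := hX' k'
      tauto
    exact Or.inl ⟨hX', hY', fun a => by simpa [hX' k, hY' k] using h a k⟩

end Control

/-- A permutation unitary of Schmidt rank two is a controlled permutation, the control being on one
of the two sides. -/
theorem IsPermutationUnitary.isControlledPermutation {dA dB : ℕ}
    {U : Matrix (Fin dA × Fin dB) (Fin dA × Fin dB) ℂ}
    (hU : IsPermutationUnitary U) (hr : HasSchmidtRank U 2) :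
    IsControlledPermutation U ∨ IsControlledPermutation (U.submatrix Prod.swap Prod.swap) := by
  obtain ⟨i, j, i', j', k, l, k', l', h1, h2, h3, h4⟩ := hU.exists_identity_minor hr
  have hdec := hr.eq_of_identity_minor h1 h2 h3 h4
  have hpp := hU.isPartialPermutation
  have hpA : ∀ k l, IsPartialPermutation (Matrix.of fun a b => U (a, k) (b, l)) := fun k l =>
    ⟨fun _ _ => hU.2 _ _, fun h h' => (Prod.mk.inj (hpp.row h h')).1,
      fun h h' => (Prod.mk.inj (hpp.col h h')).1⟩
  have hpX : ∀ i j, IsPartialPermutation (Matrix.of fun c d => U (i, c) (j, d)) := fun i j =>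
    ⟨fun _ _ => hU.2 _ _, fun h h' => (Prod.mk.inj (hpp.row h h')).2,
      fun h h' => (Prod.mk.inj (hpp.col h h')).2⟩
  have hA := hpA k l
  have hB := hpA k' l'
  have hX := hpX i j
  have hY := hpX i' j'
  have hAij : (Matrix.of fun a b => U (a, k) (b, l)) i j = 1 := h1
  have hBij : (Matrix.of fun a b => U (a, k') (b, l')) i' j' = 1 := h4
  have hBij0 : (Matrix.of fun a b => U (a, k') (b, l')) i j = 0 := h2
  have hXkl : (Matrix.of fun c d => U (i, c) (j, d)) k l = 1 := h1
  have hYkl : (Matrix.of fun c d => U (i', c) (j', d)) k' l' = 1 := h4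
  have hYkl0 : (Matrix.of fun c d => U (i', c) (j', d)) k l = 0 := h3
  generalize (Matrix.of fun a b => U (a, k) (b, l)) = A at *
  generalize (Matrix.of fun a b => U (a, k') (b, l')) = B at *
  generalize (Matrix.of fun c d => U (i, c) (j, d)) = X at *
  generalize (Matrix.of fun c d => U (i', c) (j', d)) = Y at *
  clear h1 h2 h3 h4 hpA hpX hpp hr
  subst hdec
  -- The transpose turns the row analysis into the column analysis.
  have hUT : IsPermutationUnitary (Aᵀ ⊗ₖ Xᵀ + Bᵀ ⊗ₖ Yᵀ) := by
    have := hU.transpose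
    rwa [Matrix.transpose_add, ← Matrix.kroneckerMap_transpose, ← Matrix.kroneckerMap_transpose]
      at this
  have hrow := forall_or_forall_of_xor (row_xor hU hA hB hX hY) ⟨j, hAij⟩ ⟨j', hBij⟩ ⟨l, hXkl⟩
    ⟨l', hYkl⟩
  have hcol := forall_or_forall_of_xor
    (row_xor hUT hA.transpose hB.transpose hX.transpose hY.transpose) ⟨i, hAij⟩ ⟨i', hBij⟩
    ⟨k, hXkl⟩ ⟨k', hYkl⟩
  rcases hrow with ⟨hX1, hY1, hAB⟩ | ⟨hA1, hB1, hXY⟩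
  · have hcX := hX.col_ne_of_row_ne hX1
    have hcY := hY.col_ne_of_row_ne hY1
    rcases hcol with ⟨-, -, hABc⟩ | ⟨-, -, hXYc⟩
    · exact Or.inl (isControlledPermutation_of_partial hA hB hX hY hAB hABc hcX hcY hAij hBij
        hXkl hYkl0)
    -- The mixed case is impossible: `X` and `Y` have no empty column, so their column supports are
    -- not complementary.
    · exact absurd (hcY l) ((hXYc l).1 (hcX l))
  · have hcA := hA.col_ne_of_row_ne hA1
    have hcB := hB.col_ne_of_row_ne hB1
    rcases hcol with ⟨-, -, hABc⟩ | ⟨-, -, hXYc⟩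
    · exact absurd (hcB j) ((hABc j).1 (hcA j))
    · have hswap : (A ⊗ₖ X + B ⊗ₖ Y).submatrix Prod.swap Prod.swap = X ⊗ₖ A + Y ⊗ₖ B := by
        ext ⟨a, b⟩ ⟨c, d⟩
        simp [mul_comm]
      rw [hswap]
      exact Or.inr (isControlledPermutation_of_partial hX hY hA hB hXY hXYc hcA hcB hXkl hYkl
        hAij hBij0)

/-! ### A one-ebit protocol for controlled permutations -/

/-- The isometry `|i⟩ ↦ |i⟩|t⟩` that appends an ancilla in the state `t`. -/
def appendBasis (d : ℕ) {m : ℕ} (t : Fin m) : Matrix (Fin (d * m)) (Fin d) ℂ :=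
  Matrix.of fun x i => if x = finProdFinEquiv (i, t) then 1 else 0

theorem appendBasis_conjTranspose_mul {d m : ℕ} (s t : Fin m) :
    (@appendBasis d m s)ᴴ * (@appendBasis d m t) =
      if s = t then 1 else 0 := by
  ext i j
  simp only [Matrix.mul_apply, Matrix.conjTranspose_apply, appendBasis, Matrix.of_apply,
    apply_ite star, star_one, star_zero, ite_mul, one_mul, zero_mul, Finset.sum_ite_eq',
    Finset.mem_univ, if_true, EmbeddingLike.apply_eq_iff_eq, Prod.mk.injEq]
  by_cases h : s = t <;> simp [h, Matrix.one_apply]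

theorem sum_appendBasis_mul_conjTranspose {d m : ℕ} :
    ∑ t, (@appendBasis d m t) * (@appendBasis d m t)ᴴ = 1 := by
  ext x y
  obtain ⟨⟨i, s⟩, rfl⟩ := finProdFinEquiv.surjective x
  obtain ⟨⟨j, t⟩, rfl⟩ := finProdFinEquiv.surjective y
  simp only [Matrix.sum_apply, Matrix.mul_apply, Matrix.conjTranspose_apply, appendBasis,
    Matrix.of_apply, apply_ite star, star_one, star_zero, EmbeddingLike.apply_eq_iff_eq,
    Prod.mk.injEq, Matrix.one_apply]
  rw [Finset.sum_eq_single s, Finset.sum_eq_single i]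
  · simp [eq_comm]
  · intro k _ hk
    simp [hk.symm]
  · simp
  · intro r _ hr
    simp [hr.symm]
  · simp

/-- The operator `u ↦ u ⊗ ψ`. -/
def appendResource (dA dB : ℕ) {m n : ℕ} (ψ : Fin m × Fin n → ℂ) :
    Matrix (Fin (dA * m) × Fin (dB * n)) (Fin dA × Fin dB) ℂ :=
  ∑ p : Fin m × Fin n, ψ p • (appendBasis dA p.1 ⊗ₖ appendBasis dB p.2)

theorem appendResource_apply {dA dB m n : ℕ} (ψ : Fin m × Fin n → ℂ) (i : Fin dA) (s : Fin m)
    (k : Fin dB) (t : Fin n) (x : Fin dA × Fin dB) :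
    appendResource dA dB ψ (finProdFinEquiv (i, s), finProdFinEquiv (k, t)) x =
      if x = (i, k) then ψ (s, t) else 0 := by
  rw [appendResource, Matrix.sum_apply, Finset.sum_eq_single (s, t)]
  · rcases x with ⟨a, b⟩
    simp only [Matrix.smul_apply, Matrix.kronecker_apply, appendBasis, Matrix.of_apply,
      EmbeddingLike.apply_eq_iff_eq, Prod.mk.injEq, smul_eq_mul]
    by_cases h1 : a = i <;> by_cases h2 : b = k <;> simp [h1, h2, Ne.symm]
  · rintro ⟨s', t'⟩ _ hne
    simp only [Matrix.smul_apply, appendBasis, smul_eq_mul]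
    by_cases h1 : s = s'
    · have h2 : t ≠ t' := fun h2 => hne (by rw [h1, h2])
      simp [h2]
    · simp [h1]
  · simp

theorem withResource_eq_mul {dA dB m n : ℕ} (ρ : Matrix (Fin dA × Fin dB) (Fin dA × Fin dB) ℂ)
    (ψ : Fin m × Fin n → ℂ) :
    withResource ρ ψ = appendResource dA dB ψ * ρ * (appendResource dA dB ψ)ᴴ := by
  ext ⟨x, x'⟩ ⟨y, y'⟩
  obtain ⟨⟨i, s⟩, rfl⟩ := finProdFinEquiv.surjective x
  obtain ⟨⟨k, t⟩, rfl⟩ := finProdFinEquiv.surjective x'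
  obtain ⟨⟨j, s'⟩, rfl⟩ := finProdFinEquiv.surjective y
  obtain ⟨⟨l, t'⟩, rfl⟩ := finProdFinEquiv.surjective y'
  simp only [Matrix.mul_apply, Matrix.conjTranspose_apply, appendResource_apply, apply_ite star,
    star_zero, ite_mul, mul_ite, zero_mul, mul_zero, Finset.sum_ite_eq',
    Finset.mem_univ, if_true]
  simp [withResource, Matrix.vecMulVec_apply, Equiv.prodProdProdComm, -finProdFinEquiv_symm_apply]
  ring

namespace IsControlPair

variable {dA dB : ℕ} {P Q : Matrix (Fin dA) (Fin dA) ℂ} {V W : Matrix (Fin dB) (Fin dB) ℂ}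

/-- Kraus operators of the first measurement of the controlling party, which correlates the control
with the partner's half of the ebit. -/
def correlate (P Q : Matrix (Fin dA) (Fin dA) ℂ) (m : Fin 2) :
    Matrix (Fin dA) (Fin (dA * 2)) ℂ :=
  P * (appendBasis dA m)ᴴ + Q * (appendBasis dA (m + 1))ᴴ

/-- The sign `(-1) ^ s`. -/
def sign (s : Fin 2) : ℂ := if s = 0 then 1 else -1

/-- Kraus operators of the partner, who applies `V` or `W` and measures the half of the ebit in the
Fourier basis. -/
def act (V W : Matrix (Fin dB) (Fin dB) ℂ) (m s : Fin 2) : Matrix (Fin dB) (Fin (dB * 2)) ℂ :=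
  ((√2)⁻¹ : ℂ) • (V * (appendBasis dB m)ᴴ + sign s • (W * (appendBasis dB (m + 1))ᴴ))

/-- The phase correction by the controlling party. -/
def correct (P Q : Matrix (Fin dA) (Fin dA) ℂ) (s : Fin 2) : Matrix (Fin dA) (Fin dA) ℂ :=
  P * Pᴴ + sign s • (Q * Qᴴ)

theorem initial_orth' (h : IsControlPair P Q V W) : Qᴴ * P = 0 := by
  simpa using congrArg Matrix.conjTranspose h.initial_orth

theorem mul_conjTranspose_mul_left (h : IsControlPair P Q V W) : P * Pᴴ * P = P := by
  have := congrArg (P * ·) h.initial_add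
  simpa [mul_add, ← mul_assoc, h.final_orth] using this

theorem mul_conjTranspose_mul_right (h : IsControlPair P Q V W) : Q * Qᴴ * Q = Q := by
  have h1 : Q * Pᴴ = 0 := by simpa using congrArg Matrix.conjTranspose h.final_orth
  have := congrArg (Q * ·) h.initial_add
  simpa [mul_add, ← mul_assoc, h1] using this

theorem sign_mul_self (s : Fin 2) : sign s * sign s = 1 := by
  fin_cases s <;> simp [sign]

theorem star_sign (s : Fin 2) : star (sign s) = sign s := by
  fin_cases s <;> simp [sign]

theorem appendBasis_completeness {d : ℕ} (m : Fin 2) :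
    appendBasis d m * (appendBasis d m)ᴴ + appendBasis d (m + 1) * (appendBasis d (m + 1))ᴴ = 1 := by
  rw [← sum_appendBasis_mul_conjTranspose, Fin.sum_univ_two]
  fin_cases m
  · rfl
  · exact add_comm _ _

/-- Cross terms vanish because `P` and `Q` have orthogonal ranges. Over the two outcomes, each
ancilla state meets both `Pᴴ P` and `Qᴴ Q`, which add up to 1. -/
theorem sum_correlate (h : IsControlPair P Q V W) :
    ∑ m, (correlate P Q m)ᴴ * correlate P Q m = 1 := by
  have key : ∀ m, (correlate P Q m)ᴴ * correlate P Q m =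
      appendBasis dA m * (Pᴴ * P) * (appendBasis dA m)ᴴ +
        appendBasis dA (m + 1) * (Qᴴ * Q) * (appendBasis dA (m + 1))ᴴ := by
    intro m
    have e1 : ∀ X : Matrix (Fin dA) (Fin (dA * 2)) ℂ, Pᴴ * (Q * X) = 0 := fun X => by
      rw [← Matrix.mul_assoc, h.initial_orth, Matrix.zero_mul]
    have e2 : ∀ X : Matrix (Fin dA) (Fin (dA * 2)) ℂ, Qᴴ * (P * X) = 0 := fun X => by
      rw [← Matrix.mul_assoc, h.initial_orth', Matrix.zero_mul]
    simp only [correlate, Matrix.conjTranspose_add, Matrix.conjTranspose_mul,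
      Matrix.conjTranspose_conjTranspose, Matrix.add_mul, Matrix.mul_add, Matrix.mul_assoc, e1, e2,
      Matrix.mul_zero, add_zero, zero_add]
  have key2 : ∀ t : Fin 2, appendBasis dA t * (Pᴴ * P) *
      (appendBasis dA t)ᴴ + appendBasis dA t * (Qᴴ * Q) * (appendBasis dA t)ᴴ =
      appendBasis dA t * (appendBasis dA t)ᴴ := by
    intro t
    rw [← Matrix.add_mul, ← Matrix.mul_add, h.initial_add, Matrix.mul_one]
  rw [Fin.sum_univ_two, key, key, show (1 + 1 : Fin 2) = 0 from rfl, zero_add,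
    ← sum_appendBasis_mul_conjTranspose, Fin.sum_univ_two, ← key2, ← key2]
  abel

theorem sum_act (h : IsControlPair P Q V W) (m : Fin 2) :
    ∑ s, (act V W m s)ᴴ * act V W m s = 1 := by
  have e1 : ∀ X : Matrix (Fin dB) (Fin (dB * 2)) ℂ, Vᴴ * (V * X) = X := fun X => by
    rw [← Matrix.mul_assoc, h.isometry_left, Matrix.one_mul]
  have e2 : ∀ X : Matrix (Fin dB) (Fin (dB * 2)) ℂ, Wᴴ * (W * X) = X := fun X => by
    rw [← Matrix.mul_assoc, h.isometry_right, Matrix.one_mul]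
  have hs : star ((√2)⁻¹ : ℂ) = ((√2)⁻¹ : ℂ) := by simp
  have key : ∀ s, (act V W m s)ᴴ * act V W m s = (1 / 2 : ℂ) • (1 +
      sign s • (appendBasis dB m * (Vᴴ * (W * (appendBasis dB (m + 1))ᴴ)) +
        appendBasis dB (m + 1) * (Wᴴ * (V * (appendBasis dB m)ᴴ)))) := by
    intro s
    rw [← appendBasis_completeness m, ← sqrt_two_inv_mul_self]
    simp only [act, Matrix.conjTranspose_add, Matrix.conjTranspose_mul, Matrix.conjTranspose_smul,
      Matrix.conjTranspose_conjTranspose, Matrix.add_mul, Matrix.mul_add, Matrix.mul_assoc, e1, e2,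
      hs, star_sign, Matrix.smul_mul, Matrix.mul_smul, smul_smul, smul_add, star_mul']
    rw [show (√2 : ℂ)⁻¹ * sign s * (√2 : ℂ)⁻¹ = (√2 : ℂ)⁻¹ * (√2 : ℂ)⁻¹ * sign s by ring,
      show (√2 : ℂ)⁻¹ * sign s * ((√2 : ℂ)⁻¹ * sign s) = (√2 : ℂ)⁻¹ * (√2 : ℂ)⁻¹ by
        linear_combination (√2 : ℂ)⁻¹ * (√2 : ℂ)⁻¹ * sign_mul_self s,
      ← mul_assoc (√2 : ℂ)⁻¹]
    abel
  -- The cross terms carry `sign s` and cancel between the two outcomes.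
  rw [Fin.sum_univ_two, key, key]
  simp only [sign, if_true, one_ne_zero, if_false, smul_add, neg_smul, one_smul, smul_neg]
  module

theorem correct_mul_left (h : IsControlPair P Q V W) (s : Fin 2) : correct P Q s * P = P := by
  rw [correct, Matrix.add_mul, h.mul_conjTranspose_mul_left, Matrix.smul_mul, Matrix.mul_assoc Q,
    h.initial_orth', Matrix.mul_zero, smul_zero, add_zero]

theorem correct_mul_right (h : IsControlPair P Q V W) (s : Fin 2) :
    correct P Q s * Q = sign s • Q := by
  rw [correct, Matrix.add_mul, Matrix.smul_mul, h.mul_conjTranspose_mul_right, Matrix.mul_assoc P,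
    h.initial_orth, Matrix.mul_zero, zero_add]

theorem sum_correct (h : IsControlPair P Q V W) (s : Fin 2) :
    ∑ _i : Fin 1, (correct P Q s)ᴴ * correct P Q s = 1 := by
  have hself : (correct P Q s)ᴴ = correct P Q s := by
    simp [correct, star_sign]
  rw [Fin.sum_univ_one, hself]
  conv_lhs => rhs; rw [correct]
  rw [Matrix.mul_add]
  rw [Matrix.mul_smul, ← Matrix.mul_assoc, ← Matrix.mul_assoc, h.correct_mul_left,
    h.correct_mul_right, Matrix.smul_mul, smul_smul, sign_mul_self, one_smul, h.final_add]

theorem correlate_mul_appendBasis (m t : Fin 2) :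
    correlate P Q m * appendBasis dA t = (if m = t then P else 0) + if m + 1 = t then Q else 0 := by
  simp only [correlate, Matrix.add_mul, Matrix.mul_assoc, appendBasis_conjTranspose_mul, mul_ite,
    Matrix.mul_one, Matrix.mul_zero]

theorem act_mul_appendBasis (m s t : Fin 2) :
    act V W m s * appendBasis dB t =
      ((√2)⁻¹ : ℂ) • ((if m = t then V else 0) + if m + 1 = t then sign s • W else 0) := by
  simp only [act, Matrix.add_mul, Matrix.smul_mul, Matrix.mul_assoc, appendBasis_conjTranspose_mul,
    mul_ite, Matrix.mul_one, Matrix.mul_zero, smul_ite, smul_zero]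

/-- The one-ebit protocol for a controlled unitary with the control on Alice's side. -/
def protocol (h : IsControlPair P Q V W) : LOCC dA dB (dA * 2) (dB * 2) :=
  .alice 2 (fun _ => dA) (correlate P Q) h.sum_correlate fun m =>
    .bob 2 (fun _ => dB) (act V W m) (h.sum_act m) fun s =>
      .alice 1 (fun _ => dA) (fun _ => correct P Q s) (h.sum_correct s) fun _ => .halt

/-- The ebit `(|00⟩ + |11⟩) / √2`. -/
abbrev ebit : Fin 2 × Fin 2 → ℂ := bellState 0 1 0 1

theorem appendResource_ebit : appendResource dA dB ebit =
      ((√2)⁻¹ : ℂ) • (appendBasis dA 0 ⊗ₖ appendBasis dB 0 +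
        appendBasis dA 1 ⊗ₖ appendBasis dB 1) := by
  simp [appendResource, ebit, bellState, prodVec, Fintype.sum_prod_type, Fin.sum_univ_two,
    Pi.single_apply, smul_add]

/-- In `Fin 2`, `m + 1` is the other bit. The ebit gives both parties the same bit `t`: `t = m`
selects `P ⊗ V`, and `t = m + 1` selects `Q ⊗ W` with the phase `sign s`, which the correction
removes. Every branch thus yields the same operator; the factor 1/2 combines the ebit and Fourier
normalisations. -/
theorem branch_eq (h : IsControlPair P Q V W) (m s : Fin 2) :
    (correct P Q s ⊗ₖ (1 : Matrix (Fin dB) (Fin dB) ℂ)) *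
      (((1 : Matrix (Fin dA) (Fin dA) ℂ) ⊗ₖ act V W m s) *
        ((correlate P Q m ⊗ₖ (1 : Matrix (Fin (dB * 2)) (Fin (dB * 2)) ℂ)) *
          appendResource dA dB ebit)) = (1 / 2 : ℂ) • (P ⊗ₖ V + Q ⊗ₖ W) := by
  simp only [appendResource_ebit, Matrix.mul_smul, Matrix.mul_add, ← Matrix.mul_kronecker_mul,
    Matrix.one_mul, correlate_mul_appendBasis, act_mul_appendBasis]
  rw [← sqrt_two_inv_mul_self]
  fin_cases m
  · simp only [Fin.zero_eta, zero_add, if_true, zero_ne_one, one_ne_zero, if_false, add_zero,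
      Matrix.kronecker_smul, smul_smul, h.correct_mul_left, h.correct_mul_right, smul_add]
    simp only [Matrix.mul_zero, add_zero, zero_add, Matrix.smul_kronecker, smul_smul, mul_assoc,
      sign_mul_self, mul_one]
  · simp only [Fin.mk_one, show (1 + 1 : Fin 2) = 0 from rfl, if_true, zero_ne_one, one_ne_zero,
      if_false, add_zero, zero_add,
      Matrix.kronecker_smul, smul_smul, h.correct_mul_left, h.correct_mul_right, smul_add]
    simp only [Matrix.mul_zero, add_zero, zero_add, Matrix.smul_kronecker, smul_smul, mul_assoc,
      sign_mul_self, mul_one]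
    exact add_comm _ _

theorem protocol_implements (h : IsControlPair P Q V W) :
    h.protocol.Implements ebit (P ⊗ₖ V + Q ⊗ₖ W) := by
  intro ρ
  have key : ∀ {κ ι : Type} [Fintype κ] [Fintype ι] (L : Matrix κ ι ℂ)
      (M : Matrix ι (Fin dA × Fin dB) ℂ),
      L * (M * ρ * Mᴴ) * Lᴴ = (L * M) * ρ * (L * M)ᴴ := by
    intro κ ι _ _ L M
    simp only [Matrix.conjTranspose_mul, Matrix.mul_assoc]
  simp only [protocol, LOCC.channel, withResource_eq_mul, key, h.branch_eq]
  simp only [Fin.sum_univ_two, Fin.sum_univ_one, Matrix.conjTranspose_smul, Matrix.smul_mul,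
    Matrix.mul_smul, smul_smul]
  -- Four branches, each of weight `(1/2)² = 1/4`.
  rw [← add_smul, ← add_smul]
  norm_num

end IsControlPair

/-! ### Exchanging the parties -/

/-- The protocol with the roles of the parties exchanged. -/
def LOCC.swap {a' b' : ℕ} : {a b : ℕ} → LOCC a' b' a b → LOCC b' a' b a
  | _, _, .halt => .halt
  | _, _, .alice k c K hK next => .bob k c K hK fun i => (next i).swap
  | _, _, .bob k c K hK next => .alice k c K hK fun i => (next i).swap

theorem submatrix_swap_conj {a b c d : ℕ} (A : Matrix (Fin c) (Fin a) ℂ)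
    (B : Matrix (Fin d) (Fin b) ℂ) (ρ : Matrix (Fin a × Fin b) (Fin a × Fin b) ℂ) :
    ((A ⊗ₖ B) * ρ * (A ⊗ₖ B)ᴴ).submatrix Prod.swap Prod.swap =
      (B ⊗ₖ A) * ρ.submatrix Prod.swap Prod.swap * (B ⊗ₖ A)ᴴ := by
  have h : (B ⊗ₖ A) = (A ⊗ₖ B).submatrix (Equiv.prodComm _ _) (Equiv.prodComm _ _) := by
    ext ⟨i, j⟩ ⟨k, l⟩
    simp [mul_comm]
  rw [h, Matrix.conjTranspose_submatrix]
  rw [show ρ.submatrix Prod.swap Prod.swap =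
    ρ.submatrix (Equiv.prodComm (Fin b) (Fin a)) (Equiv.prodComm (Fin b) (Fin a)) from rfl]
  rw [Matrix.submatrix_mul_equiv, Matrix.submatrix_mul_equiv]
  rfl

theorem LOCC.channel_swap {a' b' a b : ℕ} (P : LOCC a' b' a b)
    (ρ : Matrix (Fin a × Fin b) (Fin a × Fin b) ℂ) :
    P.swap.channel (ρ.submatrix Prod.swap Prod.swap) =
      (P.channel ρ).submatrix Prod.swap Prod.swap := by
  induction P with
  | halt => rfl
  | alice k c K hK next ih =>
    simp only [LOCC.swap, LOCC.channel, ← submatrix_swap_conj, ih]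
    ext
    simp [Matrix.sum_apply]
  | bob k c K hK next ih =>
    simp only [LOCC.swap, LOCC.channel, ← submatrix_swap_conj, ih]
    ext
    simp [Matrix.sum_apply]

theorem withResource_swap {dA dB m n : ℕ} (ρ : Matrix (Fin dA × Fin dB) (Fin dA × Fin dB) ℂ)
    (ψ : Fin m × Fin n → ℂ) :
    withResource (ρ.submatrix Prod.swap Prod.swap) (ψ ∘ Prod.swap) =
      (withResource ρ ψ).submatrix Prod.swap Prod.swap := by
  ext ⟨x, x'⟩ ⟨y, y'⟩
  simp [withResource, Matrix.vecMulVec_apply, Equiv.prodProdProdComm]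

theorem LOCC.Implements.swap {dA dB m n : ℕ} {P : LOCC dA dB (dA * m) (dB * n)}
    {ψ : Fin m × Fin n → ℂ} {U : Matrix (Fin dA × Fin dB) (Fin dA × Fin dB) ℂ}
    (h : P.Implements ψ U) :
    P.swap.Implements (ψ ∘ Prod.swap) (U.submatrix Prod.swap Prod.swap) := by
  intro ρ
  have h1 : ρ = (ρ.submatrix Prod.swap Prod.swap).submatrix Prod.swap Prod.swap := by
    ext; simp
  rw [h1, withResource_swap, LOCC.channel_swap, h]
  have hU : ∀ M N : Matrix (Fin dA × Fin dB) (Fin dA × Fin dB) ℂ,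
      (M * N).submatrix Prod.swap Prod.swap =
        M.submatrix Prod.swap Prod.swap * N.submatrix Prod.swap Prod.swap := fun M N =>
    (Matrix.submatrix_mul_equiv M N Prod.swap (Equiv.prodComm _ _) Prod.swap).symm
  rw [hU, hU, Matrix.conjTranspose_submatrix]

theorem ebit_swap : IsControlPair.ebit ∘ Prod.swap = IsControlPair.ebit := by
  ext ⟨i, j⟩
  simp [bellState, prodVec, mul_comm]

/-! ### Entangling power and entanglement cost -/

theorem sqNorm_unitary_mulVec {ι : Type*} [Fintype ι] [DecidableEq ι] {U : Matrix ι ι ℂ}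
    (hU : U ∈ Matrix.unitaryGroup ι ℂ) (u : ι → ℂ) : sqNorm (U *ᵥ u) = sqNorm u := by
  have h := sum_sqNorm_mulVec (κ := Unit) (γ := fun _ => ι) (L := fun _ => U)
    (by simpa [Matrix.star_eq_conjTranspose] using Matrix.mem_unitaryGroup_iff'.1 hU) u
  simpa using h

theorem isPureState_outputState {dA dB rA rB : ℕ}
    {U : Matrix (Fin dA × Fin dB) (Fin dA × Fin dB) ℂ}
    (hU : U ∈ Matrix.unitaryGroup (Fin dA × Fin dB) ℂ) {α : Fin dA × Fin rA → ℂ}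
    {β : Fin dB × Fin rB → ℂ} (hα : IsPureState α) (hβ : IsPureState β) :
    IsPureState (outputState U α β) := by
  -- Slice along the ancilla indices: on each slice the output is `U` applied to the input.
  have key : ∀ u : (Fin dA × Fin rA) × (Fin dB × Fin rB) → ℂ,
      sqNorm u = ∑ q : Fin rA × Fin rB,
        sqNorm fun p : Fin dA × Fin dB => u ((p.1, q.1), (p.2, q.2)) := by
    intro u
    simp only [sqNorm]
    rw [← (Equiv.prodProdProdComm (Fin dA) (Fin dB) (Fin rA) (Fin rB)).sum_comp,
      Fintype.sum_prod_type, Finset.sum_comm]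
    rfl
  have h1 : sqNorm (prodVec α β) = 1 := by
    rw [sqNorm_prodVec, show sqNorm α = 1 from hα, show sqNorm β = 1 from hβ, one_mul]
  change sqNorm _ = 1
  rw [← h1, key, key]
  exact Finset.sum_congr rfl fun q _ =>
    sqNorm_unitary_mulVec hU fun p : Fin dA × Fin dB => prodVec α β ((p.1, q.1), (p.2, q.2))

theorem outputState_eq_sum {dA dB rA rB r : ℕ} (S : Fin r → Matrix (Fin dA) (Fin dA) ℂ)
    (T : Fin r → Matrix (Fin dB) (Fin dB) ℂ) (α : Fin dA × Fin rA → ℂ) (β : Fin dB × Fin rB → ℂ) :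
    outputState (∑ j, S j ⊗ₖ T j) α β =
      ∑ j, prodVec (fun x => ∑ i, S j x.1 i * α (i, x.2)) fun y => ∑ k, T j y.1 k * β (k, y.2) := by
  ext x
  simp only [outputState, Finset.sum_apply, prodVec, Matrix.sum_apply, Matrix.kronecker_apply,
    Finset.sum_mul, Fintype.sum_prod_type]
  rw [Finset.sum_congr rfl fun _ _ => Finset.sum_comm, Finset.sum_comm]
  refine Finset.sum_congr rfl fun _ _ => Finset.sum_congr rfl fun _ _ => ?_
  rw [Finset.mul_sum]
  exact Finset.sum_congr rfl fun _ _ => by ring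

theorem entanglement_outputState_le_one {dA dB rA rB : ℕ}
    {U : Matrix (Fin dA × Fin dB) (Fin dA × Fin dB) ℂ}
    (hU : U ∈ Matrix.unitaryGroup (Fin dA × Fin dB) ℂ) (hr : HasSchmidtRank U 2)
    {α : Fin dA × Fin rA → ℂ} {β : Fin dB × Fin rB → ℂ} (hα : IsPureState α)
    (hβ : IsPureState β) : entanglement (outputState U α β) ≤ 1 := by
  have h := isPureState_outputState hU hα hβ
  obtain ⟨S, T, -, -, rfl⟩ := hr
  rw [outputState_eq_sum] at h ⊢
  exact entanglement_le_one _ _ h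

theorem entanglement_bellState {α β : Type*} [Fintype α] [Fintype β] [DecidableEq α]
    [DecidableEq β] {i i' : α} {k k' : β} (hi : i ≠ i') (hk : k ≠ k') :
    entanglement (bellState i i' k k') = 1 := by
  have h := isPureState_bellState k k' hi
  refine le_antisymm ?_ (one_le_entanglement h (productOverlapLE_bellState hi hk))
  have h2 : bellState i i' k k' = ∑ j : Fin 2, prodVec
      (((√2)⁻¹ : ℂ) • Pi.single (![i, i'] j) 1) (Pi.single (![k, k'] j) 1) := by
    ext x
    simp [bellState, prodVec, mul_add, mul_assoc]
  rw [h2] at h ⊢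
  exact entanglement_le_one _ _ h

/-- `U` sends some product of unit vectors to a maximally entangled state of Schmidt rank two. -/
def CreatesEbit {α β : Type*} [Fintype α] [DecidableEq α] [Fintype β] [DecidableEq β]
    (U : Matrix (α × β) (α × β) ℂ) : Prop :=
  ∃ (a : α → ℂ) (b : β → ℂ) (i i' : α) (k k' : β), IsPureState a ∧ IsPureState b ∧ i ≠ i' ∧
    k ≠ k' ∧ U *ᵥ prodVec a b = bellState i i' k k'

theorem IsPermutationUnitary.mulVec_prodVec_single {α β : Type*} [Fintype α] [DecidableEq α]
    [Fintype β] [DecidableEq β] {U : Matrix (α × β) (α × β) ℂ} (hU : IsPermutationUnitary U)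
    {i j : α} {k l : β} (h : U (i, k) (j, l) = 1) :
    U *ᵥ prodVec (Pi.single j 1) (Pi.single l 1) = prodVec (Pi.single i 1) (Pi.single k 1) := by
  have hs : ∀ (x : α) (y : β), prodVec (Pi.single x (1 : ℂ)) (Pi.single y (1 : ℂ)) =
      Pi.single (x, y) 1 := by
    intro x y
    ext ⟨c, d⟩
    simp only [prodVec, Pi.single_apply, Prod.mk.injEq]
    by_cases hc : c = x <;> by_cases hd : d = y <;> simp [hc, hd]
  rw [hs, hs, Matrix.mulVec_single_one]
  ext x
  rw [Matrix.col_apply, Pi.single_apply]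
  split_ifs with hx
  · rw [hx, h]
  · exact (hU.2 _ _).resolve_right fun h' => hx (hU.isPartialPermutation.col h' h)

theorem isPureState_single {α : Type*} [Fintype α] [DecidableEq α] (i : α) :
    IsPureState (Pi.single i (1 : ℂ)) := by
  rw [IsPureState, Finset.sum_eq_single i]
  · simp
  · intro j _ hj
    simp [hj]
  · simp

theorem isPureState_superposition {α : Type*} [Fintype α] [DecidableEq α] {i i' : α}
    (hi : i ≠ i') :
    IsPureState (((√2)⁻¹ : ℂ) • (Pi.single i (1 : ℂ) + Pi.single i' (1 : ℂ))) := by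
  change sqNorm _ = 1
  have key : ∀ x, ‖(Pi.single i (1 : ℂ) + Pi.single i' (1 : ℂ) : α → ℂ) x‖ ^ 2 =
      (if x = i then 1 else 0) + (if x = i' then 1 else 0) := by
    intro x
    by_cases h1 : x = i
    · subst h1; simp [hi]
    · by_cases h2 : x = i' <;> simp [h1, h2, hi.symm]
  rw [sqNorm_smul, norm_sqrt_two_inv_sq, sqNorm]
  simp only [key, Finset.sum_add_distrib]
  simp
  norm_num

/-- The input is `(|j⟩ + |j'⟩)|l⟩ / √2`: its two terms go to basis vectors that differ on both
sides. -/
theorem IsControlledPermutation.createsEbit {α β : Type*} [Fintype α] [DecidableEq α] [Fintype β]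
    [DecidableEq β] {U : Matrix (α × β) (α × β) ℂ} (hU : IsPermutationUnitary U)
    (h : IsControlledPermutation U) : CreatesEbit U := by
  obtain ⟨-, i, i', j, j', k, k', l, hi, hj, hk, h1, h2⟩ := h
  refine ⟨_, _, i, i', k, k', isPureState_superposition hj, isPureState_single l, hi, hk, ?_⟩
  have hsum : prodVec (((√2)⁻¹ : ℂ) • (Pi.single j (1 : ℂ) + Pi.single j' (1 : ℂ)))
      (Pi.single l (1 : ℂ)) = ((√2)⁻¹ : ℂ) • (prodVec (Pi.single j 1) (Pi.single l 1) +
        prodVec (Pi.single j' 1) (Pi.single l 1)) := by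
    ext x
    simp only [prodVec, Pi.smul_apply, Pi.add_apply, smul_eq_mul]
    ring
  rw [hsum, Matrix.mulVec_smul, Matrix.mulVec_add, hU.mulVec_prodVec_single h1,
    hU.mulVec_prodVec_single h2, bellState, Fin.sum_univ_two]
  rfl

theorem CreatesEbit.of_swap {α β : Type*} [Fintype α] [DecidableEq α] [Fintype β]
    [DecidableEq β] {U : Matrix (α × β) (α × β) ℂ}
    (h : CreatesEbit (U.submatrix Prod.swap Prod.swap)) : CreatesEbit U := by
  obtain ⟨b, a, k, k', i, i', hb, ha, hk, hi, h⟩ := h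
  refine ⟨a, b, i, i', k, k', ha, hb, hi, hk, ?_⟩
  ext x
  have h1 := congrFun h x.swap
  have h2 : bellState k k' i i' x.swap = bellState i i' k k' x := by
    simp [bellState, prodVec, mul_comm]
  rw [← h2, ← h1, Matrix.mulVec, Matrix.mulVec, dotProduct, dotProduct,
    ← (Equiv.prodComm α β).sum_comp]
  simp [prodVec, mul_comm]

theorem IsPermutationUnitary.submatrix_swap {α β : Type*} [Fintype α] [DecidableEq α] [Fintype β]
    [DecidableEq β] {U : Matrix (α × β) (α × β) ℂ} (hU : IsPermutationUnitary U) :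
    IsPermutationUnitary (U.submatrix Prod.swap Prod.swap) := by
  refine ⟨?_, fun i j => hU.2 _ _⟩
  have h := Matrix.mem_unitaryGroup_iff'.1 hU.1
  rw [Matrix.mem_unitaryGroup_iff', Matrix.star_eq_conjTranspose, Matrix.conjTranspose_submatrix]
  have := Matrix.submatrix_mul_equiv Uᴴ U (Prod.swap (α := β) (β := α)) (Equiv.prodComm β α)
    Prod.swap
  rw [← Matrix.star_eq_conjTranspose, h] at this
  refine Eq.trans this ?_
  exact Matrix.submatrix_one _ Prod.swap_injective

theorem CreatesEbit.one_mem_createdEntanglements {dA dB : ℕ}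
    {U : Matrix (Fin dA × Fin dB) (Fin dA × Fin dB) ℂ} (h : CreatesEbit U) :
    1 ∈ createdEntanglements U := by
  obtain ⟨a, b, i, i', k, k', ha, hb, hi, hk, h⟩ := h
  -- One-dimensional ancillas are enough.
  refine ⟨1, 1, fun x => a x.1, fun y => b y.1, ?_, ?_, ?_⟩
  · simpa [IsPureState, Fintype.sum_prod_type] using ha
  · simpa [IsPureState, Fintype.sum_prod_type] using hb
  · have h1 : outputState U (fun x : Fin dA × Fin 1 => a x.1) (fun y : Fin dB × Fin 1 => b y.1) =
        bellState (i, 0) (i', 0) (k, 0) (k', 0) := by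
      ext ⟨⟨x, s⟩, y, t⟩
      rw [Subsingleton.elim s 0, Subsingleton.elim t 0]
      have h2 : outputState U (fun x : Fin dA × Fin 1 => a x.1) (fun y : Fin dB × Fin 1 => b y.1)
          ((x, 0), (y, 0)) = (U *ᵥ prodVec a b) (x, y) := rfl
      rw [h2, h]
      simp [bellState, prodVec, Pi.single_apply, Prod.ext_iff]
    rw [h1, entanglement_bellState (by simpa using hi) (by simpa using hk)]

/-- Run on the product input that `U` turns into a Bell state, the protocol creates that state
exactly from `ψ` and a product state. The Schmidt bound 1/2 is pulled back through the protocol, and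
the product input is then stripped off. -/
theorem CreatesEbit.one_le_of_mem_sufficientEntanglements {dA dB : ℕ}
    {U : Matrix (Fin dA × Fin dB) (Fin dA × Fin dB) ℂ} (h : CreatesEbit U) {e : ℝ}
    (he : e ∈ sufficientEntanglements U) : 1 ≤ e := by
  obtain ⟨a, b, i, i', k, k', ha, hb, hi, hk, h⟩ := h
  obtain ⟨m, n, ψ, P, hψ, hP, rfl⟩ := he
  have hch := hP (rankOne (prodVec a b))
  rw [withResource_rankOne, mul_rankOne_mul, h] at hch
  exact one_le_entanglement hψ (ProductOverlapLE.of_withResourceVec ha hb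
    (P.productOverlapLE_of_channel_eq (isPureState_bellState k k' hi) hch (by norm_num)
      (productOverlapLE_bellState hi hk)))

theorem one_mem_sufficientEntanglements {dA dB : ℕ}
    {U : Matrix (Fin dA × Fin dB) (Fin dA × Fin dB) ℂ}
    (h : IsControlledPermutation U ∨ IsControlledPermutation (U.submatrix Prod.swap Prod.swap)) :
    1 ∈ sufficientEntanglements U := by
  suffices hP : ∃ P : LOCC dA dB (dA * 2) (dB * 2), P.Implements IsControlPair.ebit U by
    obtain ⟨P, hP⟩ := hP
    exact ⟨2, 2, _, P, isPureState_bellState 0 1 zero_ne_one, hP,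
      (entanglement_bellState zero_ne_one zero_ne_one).symm⟩
  rcases h with ⟨⟨P, Q, V, W, hc, rfl⟩, -⟩ | ⟨⟨P, Q, V, W, hc, hU⟩, -⟩
  · exact ⟨_, hc.protocol_implements⟩
  · have := hc.protocol_implements.swap
    rw [← hU, ebit_swap] at this
    exact ⟨_, this⟩

theorem lemma8 {dA dB : ℕ} (U : Matrix (Fin dA × Fin dB) (Fin dA × Fin dB) ℂ)
    (hU : IsPermutationUnitary U) (hr : HasSchmidtRank U 2) :
    IsEntanglingPower U 1 ∧ IsEntanglementCost U 1 := by
  have hc := hU.isControlledPermutation hr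
  have he : CreatesEbit U := by
    rcases hc with h | h
    · exact h.createsEbit hU
    · exact (h.createsEbit hU.submatrix_swap).of_swap
  refine ⟨⟨he.one_mem_createdEntanglements, ?_⟩, ?_⟩
  · rintro e ⟨rA, rB, α, β, hα, hβ, rfl⟩
    exact entanglement_outputState_le_one hU.1 hr hα hβ
  -- The infimum is attained, by the one-ebit protocol.
  · exact IsLeast.isGLB ⟨one_mem_sufficientEntanglements hc,
      fun e => he.one_le_of_mem_sufficientEntanglements⟩

end
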